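/- **Setting.** Players $i\in\mathcal I$ ($\mathcal I$ finite) choose $x^i\in\mathbb R^{n_i}$; $x=\mathrm{col}\{x^i\}\in\mathbb R^n$. Player $i$ has a cost $J_i(x^i,x^{-i})$ and a map $g_i:\mathbb R^{n_i}\to\mathbb R^m$; the coupling constraint is $g(x)=\sum_i g_i(x^i)\le 0$. Let $F(x)=\mathrm{col}\{\nabla_{x^i}J_i(x^i,x^{-i})\}$, $G(x)=\mathrm{col}\{g_i(x^i)\}$, $\nabla G(x)=\mathrm{blkdiag}\{\nabla g_i(x^i)\}$. A *generalized Nash equilibrium* (GNE) is a feasible $x$ at which no player can lower its cost by a unilateral feasible change; it is *variational* if there is one common $\mu\in\mathbb R^m_{+}$ with $\nabla_{x^i}J_i(x)+\nabla g_i(x^i)^T\mu=0$ for all $i$ and $g(x)\in\mathcal N_{\mathbb R^m_+}(\mu)$ (normal cone). Let $L=\mathcal L\otimes I_m$, with $\mathcal L$ the Laplacian of a weighted undirected graph on $\mathcal I$ (symmetric weights, positive exactly on the edges), and let $\Pi_\Omega(x,v)=\lim_{h\to0^+}\frac{\mathrm{proj}_\Omega(x+hv)-x}{h}$ for $x \in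 \Omega$. **Assumptions.** Each $J_i$ is continuously differentiable and convex in $x^i$ for every given $x^{-i}$; each $g_i$ is differentiable with convex components; some $x$ satisfies $g(x)<0$ (Slater); the graph is connected; $F$ is monotone. For each $i$ there are compensator matrices $(\Phi_i,\Theta_i,\Psi_i)$, $(\hat\Phi_i,\hat\Theta_i,\hat\Psi_i)$, $(\bar\Phi_i,\bar\Theta_i,\bar\Psi_i=\bar\Theta_i^T)$ such that $\Theta_i,\hat\Theta_i,\bar\Theta_i$ have full column rank, $\bar\Phi_i$ is negative definite, $\bar\Theta_i$ is entrywise nonnegative, and the first two are strictly positive real in the sense that, with given matrices $P_{\tau_x^i}\succ0$, $P_{\tau_z^i}\succ0$, the linear system $\dot\tau=\Phi_i\tau+\Theta_iv$, $\eta=\Psi_i\tau$ is strictly passive with respect to $\frac12\tau^TP_{\tau_x^i}\tau$, and $\dot\tau=\hat\Phi_i\tau+\hat\Theta_iv$, $\eta=\hat\Psi_i\tau$ with respect to $\frac12\tau^TP_{\tau_z^i}\tau$ (strictly passive: $\dot V\le v^T\eta-\phi(\tau)$ for all $\tau,v$, with $\phi$ positive definite). Write $\Phi,\Theta,\dots,P_{\tau_x},P_{\tau_z}$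 for the block diagonal matrices. **Dynamics.** With outputs $x=\rho_x+\Psi\tau_x$, $\lambda=\rho_\lambda+\max\{0,\bar\Psi\tau_\lambda\}$, $z=\rho_z+\hat\Psi\tau_z$, $$\begin{aligned} \dot\rho_x&=v_x, & \dot\tau_x&=\Phi\tau_x+\Theta v_x, & v_x&=-F(x)-\nabla G(x)^T\lambda,\\ \dot\rho_\lambda&=\Pi_{\ge0}[\rho_\lambda,v_\lambda], & \dot\tau_\lambda&=\Pi_{\ge0}[\tau_\lambda,\bar\Phi\tau_\lambda+\bar\Theta v_\lambda], & v_\lambda&=G(x)-Lz-L\lambda,\\ \dot\rho_z&=v_z, & \dot\tau_z&=\hat\Phi\tau_z+\hat\Theta v_z, & v_z&=L\lambda, \end{aligned}$$ where $\Pi_{\ge0}$ is $\Pi_\Omega$ for the nonnegative orthant $\Omega$, on the states with $\rho_\lambda\ge0$, $\tau_\lambda\ge0$. Trajectories are locally absolutely continuous on $[0,\infty)$, stay in this domain, and satisfy the equations for almost every $t$. The subsystem $\Sigma^f_x$ consists of the $(\rho_x,\tau_x)$-equations with $v_x=-F(x)+u_x$ and output $y_x=x$; $\Sigma^f_{\lambda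 z}$ consists of the remaining equations with $v_\lambda=G(u_{\lambda z})-Lz-L\lambda$, $v_z=L\lambda$ and output $y_{\lambda z}=\nabla G(u_{\lambda z})^T\lambda$. A system is *passive* from $u-u^*$ to $y-y^*$ with respect to $V$ if $V$ is $C^1$, positive definite about the equilibrium state and radially unbounded, and $\dot V\le (u-u^*)^T(y-y^*)$ for all states and inputs. **Theorem.** Let $(\rho^*,\tau^*)$ be any equilibrium of the dynamics with output $(x^*,\lambda^*,z^*)$, and put $u_{\lambda z}^*=y_x^*=x^*$, $u_x^*=-y_{\lambda z}^*=-\nabla G(x^*)^T\lambda^*$. (i) $\Sigma^f_x$ is passive from $u_x-u_x^*$ to $y_x-y_x^*$ with respect to $S^f_x=\frac12\|\rho_x-x^*\|^2+\frac12\tau_x^TP_{\tau_x}\tau_x$. (ii) $\Sigma^f_{\lambda z}$ is passive from $u_{\lambda z}-u_{\lambda z}^*$ to $y_{\lambda z}-y_{\lambda z}^*$ with respect to $S^f_{\lambda z}=\frac12\|\rho_\lambda-\lambda^*\|^2+\frac12\|\rho_z-z^*\|^2+\frac12\|\tau_\lambda\|^2+\frac12\tau_z^TP_{\tau_z}\tau_z$.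 (iii) If the game has a variational GNE, then every trajectory $(\rho(t),\tau(t))$ converges as $t\to\infty$ to an equilibrium of the dynamics, and the output $x(t)$ converges to the $x$-component of its output, which is a variational GNE. -/

import Mathlib

open Set Filter Topology MeasureTheory
open scoped InnerProductSpace Matrix

noncomputable section

namespace GradientPlay

/-! ### Vectors, block vectors, cones, projections -/

/-- Euclidean space of dimension `d`. -/
abbrev Vec (d : ℕ) : Type := EuclideanSpace ℝ (Fin d)

/-- Stacked vectors `col {v_i}` with blocks `v_i ∈ ℝ^{d_i}`, with the Euclidean norm. -/
abbrev BlockVec {ι : Type*} (d : ι → ℕ) : Type _ := PiLp 2 (fun i => Vec (d i))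

/-- Stacked vectors with one block in `ℝ^m` for every agent. -/
abbrev AgentVec (ι : Type*) (m : ℕ) : Type _ := BlockVec (fun _ : ι => m)

/-- The nonnegative orthant of `ℝ^d`. -/
def orthant (d : ℕ) : Set (Vec d) := {v | ∀ k, 0 ≤ v k}

/-- The nonnegative orthant of the space of stacked vectors. -/
def blockOrthant {ι : Type*} (d : ι → ℕ) : Set (BlockVec d) := {v | ∀ i k, 0 ≤ v i k}

/-- The normal cone of `Ω` at a point `x` of `Ω`. -/
def normalCone {E : Type*} [NormedAddCommGroup E] [InnerProductSpace ℝ E] (Ω : Set E) (x : E) :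
    Set E :=
  {v | ∀ y ∈ Ω, ⟪v, y - x⟫_ℝ ≤ 0}

/-- The metric projection `proj_Ω(x) = argmin_{y ∈ Ω} ‖y - x‖`
(existing and unique when `Ω` is nonempty, closed and convex). -/
def proj {E : Type*} [NormedAddCommGroup E] (Ω : Set E) (x : E) : E :=
  Classical.epsilon fun p => p ∈ Ω ∧ ∀ y ∈ Ω, ‖p - x‖ ≤ ‖y - x‖

/-- The differentiated projection operator
`Π_Ω(x, v) = lim_{h → 0⁺} (proj_Ω (x + h v) - x) / h`; it is meaningful for `x ∈ Ω`. -/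
def projOp {E : Type*} [NormedAddCommGroup E] [NormedSpace ℝ E] (Ω : Set E) (x v : E) : E :=
  limUnder (𝓝[>] (0 : ℝ)) fun h : ℝ => h⁻¹ • (proj Ω (x + h • v) - x)

/-- The action of the block diagonal matrix `blkdiag {M_i}` on a stacked vector. -/
def blockMul {ι : Type*} {d e : ι → ℕ} (M : ∀ i, Matrix (Fin (d i)) (Fin (e i)) ℝ)
    (v : BlockVec e) : BlockVec d :=
  WithLp.toLp 2 fun i => WithLp.toLp 2 (M i *ᵥ (v i).ofLp)

/-- The entrywise maximum `max {0, v}`. -/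
def blockPos {ι : Type*} {d : ι → ℕ} (v : BlockVec d) : BlockVec d :=
  WithLp.toLp 2 fun i => WithLp.toLp 2 fun k => max 0 (v i k)

/-- The quadratic form `vᵀ P v`. -/
def quadForm {d : ℕ} (P : Matrix (Fin d) (Fin d) ℝ) (v : Vec d) : ℝ :=
  v.ofLp ⬝ᵥ (P *ᵥ v.ofLp)

/-- The quadratic form `vᵀ blkdiag {P_i} v`. -/
def blockQuadForm {ι : Type*} [Fintype ι] {d : ι → ℕ}
    (P : ∀ i, Matrix (Fin (d i)) (Fin (d i)) ℝ) (v : BlockVec d) : ℝ :=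
  ∑ i, quadForm (P i) (v i)

/-! ### Input-output systems and passivity -/

/-- An input-output system `ẋ = f(x, u)`, `y = h(x, u)` with states in `stateSet`. -/
structure IOSystem (X U : Type*) where
  /-- the set in which the state lives -/
  stateSet : Set X
  /-- the right-hand side `f` -/
  field : X → U → X
  /-- the output map `h` -/
  output : X → U → U

/-- `V` is a storage function centred at `x₀`: continuously differentiable, positive definite
about `x₀`, and radially unbounded. -/
def IsStorage {X : Type*} [NormedAddCommGroup X] [NormedSpace ℝ X] (V : X → ℝ) (x₀ : X) : Prop :=
  ContDiff ℝ 1 V ∧ V x₀ = 0 ∧ (∀ x, x ≠ x₀ → 0 < V x) ∧ Tendsto V (cocompact X) atTop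

/-- The system is passive from `u - u₀` to `y - y₀` with respect to the storage function `V`,
where `x₀` is an equilibrium state for the constant input `u₀` and `y₀` is the output there:
`V̇ = ∇V(x)ᵀ f(x, u) ≤ (u - u₀)ᵀ (y - y₀)` for all states `x` and all inputs `u`. -/
def IOSystem.IsPassive {X U : Type*} [NormedAddCommGroup X] [NormedSpace ℝ X]
    [NormedAddCommGroup U] [InnerProductSpace ℝ U] (S : IOSystem X U)
    (V : X → ℝ) (x₀ : X) (u₀ y₀ : U) : Prop :=
  x₀ ∈ S.stateSet ∧ S.field x₀ u₀ = 0 ∧ S.output x₀ u₀ = y₀ ∧ IsStorage V x₀ ∧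
    ∀ x ∈ S.stateSet, ∀ u,
      fderiv ℝ V x (S.field x u) ≤ ⟪u - u₀, S.output x u - y₀⟫_ℝ

/-- The system is strictly passive with respect to `V`:
`V̇ ≤ uᵀ y - φ(x)` for some positive definite function `φ`. -/
def IOSystem.IsStrictlyPassive {X U : Type*} [NormedAddCommGroup X] [NormedSpace ℝ X]
    [NormedAddCommGroup U] [InnerProductSpace ℝ U] (S : IOSystem X U) (V : X → ℝ) : Prop :=
  (0 : X) ∈ S.stateSet ∧ S.field 0 0 = 0 ∧ S.output 0 0 = 0 ∧ IsStorage V 0 ∧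
    ∃ φ : X → ℝ, φ 0 = 0 ∧ (∀ x, x ≠ 0 → 0 < φ x) ∧
      ∀ x ∈ S.stateSet, ∀ u, fderiv ℝ V x (S.field x u) ≤ ⟪u, S.output x u⟫_ℝ - φ x

/-- The linear system `ẋ = A x + B u`, `y = C x`. -/
def ltiSystem {d e : ℕ} (A : Matrix (Fin d) (Fin d) ℝ) (B : Matrix (Fin d) (Fin e) ℝ)
    (C : Matrix (Fin e) (Fin d) ℝ) : IOSystem (Vec d) (Vec e) where
  stateSet := univ
  field x u := WithLp.toLp 2 (A *ᵥ x.ofLp + B *ᵥ u.ofLp)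
  output x _ := WithLp.toLp 2 (C *ᵥ x.ofLp)

/-! ### The game -/

/-- A game: cost functions `J_i` of the joint action, and private constraint maps `g_i`
that make up the coupling constraint `∑ i, g_i (x^i) ≤ 0`. -/
structure Game (ι : Type*) (n : ι → ℕ) (m : ℕ) where
  /-- the cost functions -/
  J : ι → BlockVec n → ℝ
  /-- the constraint maps -/
  g : ∀ i, Vec (n i) → Vec m

section Game

variable {ι : Type*} [Fintype ι] [DecidableEq ι] {n : ι → ℕ} {m : ℕ}

/-- The joint action `(y, x^{-i})`. -/
def replace (x : BlockVec n) (i : ι) (y : Vec (n i)) : BlockVec n :=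
  WithLp.toLp 2 (Function.update x.ofLp i y)

/-- The coupling constraint function `g(x) = ∑ i, g_i (x^i)`. -/
def Game.gSum (𝒢 : Game ι n m) (x : BlockVec n) : Vec m := ∑ i, 𝒢.g i (x i)

/-- The feasible set `X = {x | g(x) ≤ 0}`. -/
def Game.feasible (𝒢 : Game ι n m) : Set (BlockVec n) := {x | ∀ k, 𝒢.gSum x k ≤ 0}

/-- The partial gradient `∇_{x^i} J_i (x^i, x^{-i})`. -/
def Game.partialGrad (𝒢 : Game ι n m) (i : ι) (x : BlockVec n) : Vec (n i) :=
  gradient (fun y : Vec (n i) => 𝒢.J i (replace x i y)) (x i)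

/-- The pseudo-gradient `F(x) = col {∇_{x^i} J_i (x^i, x^{-i})}`. -/
def Game.F (𝒢 : Game ι n m) (x : BlockVec n) : BlockVec n :=
  WithLp.toLp 2 fun i => 𝒢.partialGrad i x

/-- The pseudo-gradient is monotone. -/
def Game.IsMonotone (𝒢 : Game ι n m) : Prop :=
  ∀ x y : BlockVec n, 0 ≤ ⟪x - y, 𝒢.F x - 𝒢.F y⟫_ℝ

/-- `G(x) = col {g_i (x^i)}`. -/
def Game.G (𝒢 : Game ι n m) (x : BlockVec n) : AgentVec ι m :=
  WithLp.toLp 2 fun i => 𝒢.g i (x i)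

/-- `∇G(x)ᵀ λ = col {∇g_i (x^i)ᵀ λ^i}`. -/
def Game.gradGT (𝒢 : Game ι n m) (x : BlockVec n) (lam : AgentVec ι m) : BlockVec n :=
  WithLp.toLp 2 fun i => ContinuousLinearMap.adjoint (fderiv ℝ (𝒢.g i) (x i)) (lam i)

/-- The convexity assumption with Slater's condition: each `J_i` is continuously differentiable
and convex in `x^i` for every given `x^{-i}`, each `g_i` is differentiable with convex
components, and some point satisfies the coupling constraint strictly. -/
def Game.IsConvex (𝒢 : Game ι n m) : Prop :=
  (∀ i (x : BlockVec n), ContDiff ℝ 1 (fun y : Vec (n i) => 𝒢.J i (replace x i y)) ∧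
    ConvexOn ℝ univ (fun y : Vec (n i) => 𝒢.J i (replace x i y))) ∧
  (∀ i, Differentiable ℝ (𝒢.g i) ∧ ∀ k, ConvexOn ℝ univ (fun y : Vec (n i) => 𝒢.g i y k)) ∧
  ∃ x : BlockVec n, ∀ k, 𝒢.gSum x k < 0

/-- Generalized Nash equilibrium: `x` is feasible, and no agent can lower its cost by a
unilateral feasible change of its action. -/
def Game.IsGNE (𝒢 : Game ι n m) (x : BlockVec n) : Prop :=
  x ∈ 𝒢.feasible ∧
    ∀ i (y : Vec (n i)), replace x i y ∈ 𝒢.feasible → 𝒢.J i x ≤ 𝒢.J i (replace x i y)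

/-- Variational GNE: a GNE that satisfies the KKT conditions of all agents with one common
multiplier. -/
def Game.IsVariationalGNE (𝒢 : Game ι n m) (x : BlockVec n) : Prop :=
  𝒢.IsGNE x ∧ ∃ mu ∈ orthant m,
    (∀ i, 𝒢.partialGrad i x + ContinuousLinearMap.adjoint (fderiv ℝ (𝒢.g i) (x i)) mu = 0) ∧
    𝒢.gSum x ∈ normalCone (orthant m) mu

end Game

/-! ### The communication graph -/

section Graph

variable {ι : Type*} [Fintype ι] [DecidableEq ι]

/-- `a` is a weighted adjacency matrix of the undirected graph `Gc`. -/
def IsWeightedAdjacency (Gc : SimpleGraph ι) (a : Matrix ι ι ℝ) : Prop :=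
  (∀ i j, a i j = a j i) ∧ (∀ i j, Gc.Adj i j → 0 < a i j) ∧ ∀ i j, ¬ Gc.Adj i j → a i j = 0

/-- The Laplacian matrix `diag {∑ j, a_{ij}} - a`. -/
def laplacian (a : Matrix ι ι ℝ) : Matrix ι ι ℝ :=
  Matrix.diagonal (fun i => ∑ j, a i j) - a

/-- The action of `L = 𝓛 ⊗ I_m` on stacked vectors. -/
def lapMul {m : ℕ} (a : Matrix ι ι ℝ) (v : AgentVec ι m) : AgentVec ι m :=
  WithLp.toLp 2 fun i => ∑ j, laplacian a i j • v j

end Graph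

/-! ### The dynamics with parallel feedforward compensators -/

/-- The matrices of the compensators of all agents: `(Φx, Θx, Ψx)` for the actions,
`(Φz, Θz, Ψz)` for the auxiliary variables, and `(Φl, Θl, Θlᵀ)` for the multipliers. -/
structure Compensators (ι : Type*) (n p q r : ι → ℕ) (m : ℕ) where
  /-- state matrices of the compensators for the actions -/
  Φx : ∀ i, Matrix (Fin (p i)) (Fin (p i)) ℝ
  /-- input matrices of the compensators for the actions -/
  Θx : ∀ i, Matrix (Fin (p i)) (Fin (n i)) ℝ
  /-- output matrices of the compensators for the actions -/
  Ψx : ∀ i, Matrix (Fin (n i)) (Fin (p i)) ℝ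
  /-- state matrices of the compensators for the auxiliary variables -/
  Φz : ∀ i, Matrix (Fin (q i)) (Fin (q i)) ℝ
  /-- input matrices of the compensators for the auxiliary variables -/
  Θz : ∀ i, Matrix (Fin (q i)) (Fin m) ℝ
  /-- output matrices of the compensators for the auxiliary variables -/
  Ψz : ∀ i, Matrix (Fin m) (Fin (q i)) ℝ
  /-- state matrices of the compensators for the multipliers -/
  Φl : ∀ i, Matrix (Fin (r i)) (Fin (r i)) ℝ
  /-- input matrices of the compensators for the multipliers -/
  Θl : ∀ i, Matrix (Fin (r i)) (Fin m) ℝ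

section Dynamics

variable {ι : Type*} [Fintype ι] [DecidableEq ι] {n p q r : ι → ℕ} {m : ℕ}

/-- The output matrices `Θlᵀ` of the compensators for the multipliers. -/
def Compensators.Ψl (K : Compensators ι n p q r m) (i : ι) : Matrix (Fin m) (Fin (r i)) ℝ :=
  (K.Θl i)ᵀ

/-- The assumptions on the compensators. Those for `x` and `z` are strictly passive with respect
to `½ τᵀ P τ` with the given matrices `P ≻ 0`; those for `λ` have `Φl` negative definite and `Θl`
entrywise nonnegative; all input matrices have full column rank. -/
def Compensators.IsAdmissible (K : Compensators ι n p q r m)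
    (Px : ∀ i, Matrix (Fin (p i)) (Fin (p i)) ℝ) (Pz : ∀ i, Matrix (Fin (q i)) (Fin (q i)) ℝ) :
    Prop :=
  (∀ i, (Px i).PosDef ∧ Function.Injective (K.Θx i).mulVec ∧
    (ltiSystem (K.Φx i) (K.Θx i) (K.Ψx i)).IsStrictlyPassive
      (fun τ => (1 / 2) * quadForm (Px i) τ)) ∧
  (∀ i, (Pz i).PosDef ∧ Function.Injective (K.Θz i).mulVec ∧
    (ltiSystem (K.Φz i) (K.Θz i) (K.Ψz i)).IsStrictlyPassive
      (fun τ => (1 / 2) * quadForm (Pz i) τ)) ∧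
  (∀ i, (∀ τ : Vec (r i), τ ≠ 0 → quadForm (K.Φl i) τ < 0) ∧ (∀ k l, 0 ≤ K.Θl i k l) ∧
    Function.Injective (K.Θl i).mulVec)

/-- States `(ρ_x, τ_x)`. -/
abbrev StateX (n p : ι → ℕ) : Type _ := BlockVec n × BlockVec p

/-- States `(ρ_λ, τ_λ, ρ_z, τ_z)`. -/
abbrev StateLZ (q r : ι → ℕ) (m : ℕ) : Type _ :=
  AgentVec ι m × BlockVec r × AgentVec ι m × BlockVec q

/-- States of the whole dynamics. -/
abbrev FullState (n p q r : ι → ℕ) (m : ℕ) : Type _ := StateX n p × StateLZ q r m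

/-- `x = ρ_x + η_x` with `η_x = Ψx τ_x`. -/
def Compensators.xOut (K : Compensators ι n p q r m) : StateX n p → BlockVec n
  | (ρx, τx) => ρx + blockMul K.Ψx τx

/-- `λ = ρ_λ + η_λ` with `η_λ = max {0, Ψl τ_λ}`. -/
def Compensators.lamOut (K : Compensators ι n p q r m) : StateLZ q r m → AgentVec ι m
  | (ρl, τl, _, _) => ρl + blockPos (blockMul K.Ψl τl)

/-- `z = ρ_z + η_z` with `η_z = Ψz τ_z`. -/
def Compensators.zOut (K : Compensators ι n p q r m) : StateLZ q r m → AgentVec ι m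
  | (_, _, ρz, τz) => ρz + blockMul K.Ψz τz

/-- The right-hand side of the `(ρ_x, τ_x)`-equations driven by the signal `vx`. -/
def Compensators.fieldX (K : Compensators ι n p q r m) (vx : BlockVec n) :
    StateX n p → StateX n p
  | (_, τx) => (vx, blockMul K.Φx τx + blockMul K.Θx vx)

/-- The right-hand side of the `(ρ_λ, τ_λ, ρ_z, τ_z)`-equations driven by the signals `vl` and
`vz`. -/
def Compensators.fieldLZ (K : Compensators ι n p q r m) (vl vz : AgentVec ι m) :
    StateLZ q r m → StateLZ q r m
  | (ρl, τl, _, τz) =>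
    (projOp (blockOrthant fun _ => m) ρl vl,
     projOp (blockOrthant r) τl (blockMul K.Φl τl + blockMul K.Θl vl),
     vz,
     blockMul K.Φz τz + blockMul K.Θz vz)

/-- Admissible states `(ρ_λ, τ_λ, ρ_z, τ_z)`: those with `ρ_λ ≥ 0` and `τ_λ ≥ 0`. -/
def stateSetLZ (q r : ι → ℕ) (m : ℕ) : Set (StateLZ q r m) :=
  {s | s.1 ∈ blockOrthant (fun _ : ι => m) ∧ s.2.1 ∈ blockOrthant r}

/-- The subsystem `Σ_x`: `v_x = - F(x) + u`, `y = x`. -/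
def sigmaX (𝒢 : Game ι n m) (K : Compensators ι n p q r m) :
    IOSystem (StateX n p) (BlockVec n) where
  stateSet := univ
  field s u := K.fieldX (- 𝒢.F (K.xOut s) + u) s
  output s _ := K.xOut s

/-- The subsystem `Σ_{λz}`: `v_λ = G(u) - L z - L λ`, `v_z = L λ`, `y = ∇G(u)ᵀ λ`. -/
def sigmaLZ (𝒢 : Game ι n m) (a : Matrix ι ι ℝ) (K : Compensators ι n p q r m) :
    IOSystem (StateLZ q r m) (BlockVec n) where
  stateSet := stateSetLZ q r m
  field s u :=
    K.fieldLZ (𝒢.G u - lapMul a (K.zOut s) - lapMul a (K.lamOut s)) (lapMul a (K.lamOut s)) s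
  output s u := 𝒢.gradGT u (K.lamOut s)

/-- The right-hand side of the whole dynamics: `v_x = - F(x) - ∇G(x)ᵀ λ`,
`v_λ = G(x) - L z - L λ`, `v_z = L λ`. -/
def dynField (𝒢 : Game ι n m) (a : Matrix ι ι ℝ) (K : Compensators ι n p q r m)
    (s : FullState n p q r m) : FullState n p q r m :=
  let x := K.xOut s.1
  let lam := K.lamOut s.2
  let z := K.zOut s.2
  (K.fieldX (- 𝒢.F x - 𝒢.gradGT x lam) s.1,
   K.fieldLZ (𝒢.G x - lapMul a z - lapMul a lam) (lapMul a lam) s.2)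

/-- Equilibrium points of the dynamics. -/
def IsEquilibrium (𝒢 : Game ι n m) (a : Matrix ι ι ℝ) (K : Compensators ι n p q r m)
    (s : FullState n p q r m) : Prop :=
  s.2 ∈ stateSetLZ q r m ∧ dynField 𝒢 a K s = 0

/-- State trajectories on `[0, ∞)` of the projected dynamics: locally absolutely continuous
curves in the domain `{ρ_λ ≥ 0, τ_λ ≥ 0}` of the projected vector field (the domain on which the
operators `Π` are defined) that satisfy the differential equation at almost every time. -/
def IsTrajectory (𝒢 : Game ι n m) (a : Matrix ι ι ℝ) (K : Compensators ι n p q r m)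
    (s : ℝ → FullState n p q r m) : Prop :=
  (∀ T : ℝ, 0 < T → AbsolutelyContinuousOnInterval s 0 T) ∧
  (∀ t : ℝ, 0 ≤ t → (s t).2 ∈ stateSetLZ q r m) ∧
  ∀ᵐ t : ℝ, 0 < t → HasDerivAt s (dynField 𝒢 a K (s t)) t

/-- The storage function `½ ‖ρ_x - x*‖² + ½ τ_xᵀ P_x τ_x`. -/
def storageX (Px : ∀ i, Matrix (Fin (p i)) (Fin (p i)) ℝ) (xs : BlockVec n) :
    StateX n p → ℝ
  | (ρx, τx) => (1 / 2) * ‖ρx - xs‖ ^ 2 + (1 / 2) * blockQuadForm Px τx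

/-- The storage function
`½ ‖ρ_λ - λ*‖² + ½ ‖ρ_z - z*‖² + ½ ‖τ_λ‖² + ½ τ_zᵀ P_z τ_z`. -/
def storageLZ (Pz : ∀ i, Matrix (Fin (q i)) (Fin (q i)) ℝ) (lams zs : AgentVec ι m) :
    StateLZ q r m → ℝ
  | (ρl, τl, ρz, τz) =>
    (1 / 2) * ‖ρl - lams‖ ^ 2 + (1 / 2) * ‖ρz - zs‖ ^ 2 + (1 / 2) * ‖τl‖ ^ 2
      + (1 / 2) * blockQuadForm Pz τz

end Dynamics

end GradientPlay

end

open GradientPlay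

namespace GradientPlay

/-! ### Absolutely continuous curves -/

section AbsolutelyContinuous

variable {E F : Type*} [NormedAddCommGroup E] [NormedSpace ℝ E] [NormedAddCommGroup F]
  [NormedSpace ℝ F]

/-! At an equilibrium all compensator states vanish, and the outputs satisfy KKT conditions with a
consensual multiplier (`isEquilibrium_iff`, `IsRestPoint`). Such rest points correspond to
variational GNEs: convexity makes KKT sufficient, and connectivity of the graph lets the Laplacian
redistribute any slack that sums to zero.

Passivity is a computation with the storage functions. Strict passivity of a linear compensator
forces `P Θ = Ψᵀ`, so the integrator and compensator parts combine into a pairing of the driving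
signal with the output, plus a loss quadratic in `τ`. Monotonicity of `F`, convexity of `g`,
complementarity and positive semidefiniteness of the Laplacian give the remaining signs. The two
subsystems are in negative feedback, so their supply rates cancel and the total storage decreases at
rate at least `c ‖τ‖²`, whichever rest point it is centred at (`totalStorage_dissipation`).

For convergence, the projected field is discontinuous, so Barbalat-type arguments replace an
invariance principle. Trajectories are bounded, hence Lipschitz, and the dissipation forces `τ → 0`.
The `τ_x` and `τ_z` equations carry no projection, so their derivatives also tend to zero, and full
column rank of the input matrices gives `v_x → 0` and `v_z → 0`. For the multipliers, `ρ_x` and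
`ρ_z` now move ever more slowly, so near a cluster point `v_λ` is almost constant on long time
windows; a wrong sign would push `ρ_λ` out of its bounded range, forwards or backwards in time
(`projected_limit_complementary`). Thus every cluster point is an equilibrium. Centring the storage
at one of them turns subsequential convergence into convergence.

Two regularity facts are needed: convex differentiable functions are `C¹`, and monotonicity upgrades
continuity of each player's own partial gradient in its own action to joint continuity of `F`. -/

theorem absolutelyContinuousOnInterval_of_nonneg {X : Type*} [PseudoMetricSpace X]
    {f : ℝ → X}
    (hf : ∀ T : ℝ, 0 < T → AbsolutelyContinuousOnInterval f 0 T) {a b : ℝ} (ha : 0 ≤ a)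
    (hab : a ≤ b) : AbsolutelyContinuousOnInterval f a b := by
  refine (hf (b + 1) (by linarith)).mono ?_
  rw [uIcc_of_le hab, uIcc_of_le (by linarith)]
  exact Icc_subset_Icc ha (by linarith)

theorem absolutelyContinuousOnInterval_lipschitz_comp {X Y : Type*} [PseudoMetricSpace X]
    [PseudoMetricSpace Y] {f : ℝ → X} {g : X → Y} {a b : ℝ}
    {C : NNReal} (hf : AbsolutelyContinuousOnInterval f a b)
    (hg : LipschitzOnWith C g (f '' uIcc a b)) :
    AbsolutelyContinuousOnInterval (fun t => g (f t)) a b := by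
  rw [absolutelyContinuousOnInterval_iff] at hf ⊢
  intro ε hε
  obtain ⟨δ, hδ, h⟩ := hf (ε / (C + 1)) (by positivity)
  refine ⟨δ, hδ, fun I hI hlen => ?_⟩
  have hsum := h I hI hlen
  calc ∑ i ∈ Finset.range I.1, dist (g (f (I.2 i).1)) (g (f (I.2 i).2))
      ≤ ∑ i ∈ Finset.range I.1, (C : ℝ) * dist (f (I.2 i).1) (f (I.2 i).2) := by
        refine Finset.sum_le_sum fun i hi => ?_
        have := hI.1 i hi
        exact hg.dist_le_mul _ (mem_image_of_mem _ this.1) _ (mem_image_of_mem _ this.2)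
    _ = C * ∑ i ∈ Finset.range I.1, dist (f (I.2 i).1) (f (I.2 i).2) := by rw [Finset.mul_sum]
    _ ≤ (C + 1) * ∑ i ∈ Finset.range I.1, dist (f (I.2 i).1) (f (I.2 i).2) := by
        gcongr
        linarith
    _ < (C + 1) * (ε / (C + 1)) := by gcongr
    _ = ε := by field_simp

theorem absolutelyContinuousOnInterval_contDiff_comp [FiniteDimensional ℝ E] {f : ℝ → E}
    {g : E → F} {a b : ℝ} (hf : AbsolutelyContinuousOnInterval f a b) (hg : ContDiff ℝ 1 g) :
    AbsolutelyContinuousOnInterval (fun t => g (f t)) a b := by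
  have : ProperSpace E := FiniteDimensional.proper_real E
  have hb := (isCompact_uIcc.image_of_continuousOn hf.continuousOn).isBounded
  obtain ⟨R, hR⟩ := hb.subset_closedBall 0
  obtain ⟨C, hC⟩ := hg.contDiffOn.exists_lipschitzOnWith one_ne_zero
    (convex_closedBall (0 : E) R) (isCompact_closedBall 0 R)
  exact absolutelyContinuousOnInterval_lipschitz_comp hf (hC.mono hR)

/-- The mean value inequality for absolutely continuous functions. -/
theorem sub_le_of_ae_hasDerivAt_le {f : ℝ → ℝ} {a b c : ℝ} (hab : a ≤ b)
    (hf : AbsolutelyContinuousOnInterval f a b)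
    (h : ∀ᵐ t : ℝ, t ∈ Ioo a b → ∃ d, HasDerivAt f d t ∧ d ≤ c) :
    f b - f a ≤ c * (b - a) := by
  rw [← hf.integral_deriv_eq_sub]
  calc ∫ x in a..b, deriv f x ≤ ∫ _ in a..b, c := by
        refine intervalIntegral.integral_mono_ae_restrict hab hf.intervalIntegrable_deriv
          (by simp) ?_
        rw [← Measure.restrict_congr_set (Ioo_ae_eq_Icc (μ := volume) (a := a) (b := b)),
          EventuallyLE, ae_restrict_iff' measurableSet_Ioo]
        filter_upwards [h] with t ht htab
        obtain ⟨d, hd, hdc⟩ := ht htab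
        rwa [hd.deriv]
    _ = c * (b - a) := by simp [mul_comm]

theorem le_sub_of_ae_le_hasDerivAt {f : ℝ → ℝ} {a b c : ℝ} (hab : a ≤ b)
    (hf : AbsolutelyContinuousOnInterval f a b)
    (h : ∀ᵐ t : ℝ, t ∈ Ioo a b → ∃ d, HasDerivAt f d t ∧ c ≤ d) :
    c * (b - a) ≤ f b - f a := by
  have := sub_le_of_ae_hasDerivAt_le (c := -c) hab hf.neg (by
    filter_upwards [h] with t ht htab
    obtain ⟨d, hd, hdc⟩ := ht htab
    exact ⟨-d, hd.neg, by linarith⟩)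
  simp only [Pi.neg_apply] at this
  linarith

theorem norm_sub_le_of_ae_hasDerivAt [FiniteDimensional ℝ E] {f : ℝ → E} {a b c : ℝ}
    (hab : a ≤ b) (hf : AbsolutelyContinuousOnInterval f a b)
    (h : ∀ᵐ t : ℝ, t ∈ Ioo a b → ∃ d, HasDerivAt f d t ∧ ‖d‖ ≤ c) :
    ‖f b - f a‖ ≤ c * (b - a) := by
  -- A functional of norm at most one that attains the norm of the increment reduces the claim to
  -- the scalar case.
  obtain ⟨φ, hφ, hφe⟩ := exists_dual_vector'' ℝ (f b - f a)
  have := sub_le_of_ae_hasDerivAt_le (c := c) hab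
    (absolutelyContinuousOnInterval_contDiff_comp hf φ.contDiff) (by
      filter_upwards [h] with t ht htab
      obtain ⟨d, hd, hdc⟩ := ht htab
      refine ⟨φ d, φ.hasFDerivAt.comp_hasDerivAt t hd, ?_⟩
      calc φ d ≤ ‖φ d‖ := le_abs_self _
        _ ≤ ‖φ‖ * ‖d‖ := φ.le_opNorm d
        _ ≤ 1 * c := by gcongr
        _ = c := one_mul c)
  rw [← map_sub, hφe] at this
  exact this

/-- If `f` converges and its derivative is bounded below by a uniformly continuous function `w`,
then `limsup w ≤ 0`. -/
theorem eventually_le_of_tendsto_of_le_hasDerivAt {f w : ℝ → ℝ} {c : ℝ}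
    (hf : ∀ T : ℝ, 0 < T → AbsolutelyContinuousOnInterval f 0 T)
    (hder : ∀ᵐ t : ℝ, 0 < t → ∃ d, HasDerivAt f d t ∧ w t ≤ d)
    (hw : UniformContinuousOn w (Ici 0)) (hlim : Tendsto f atTop (𝓝 c)) {ε : ℝ} (hε : 0 < ε) :
    ∀ᶠ t in atTop, w t ≤ ε := by
  obtain ⟨δ, hδ, hwδ⟩ := Metric.uniformContinuousOn_iff.1 hw (ε / 2) (by positivity)
  -- If `w t > ε`, the derivative stays above `ε / 2` on a window of length `δ / 2`, so `f` gains
  -- more than `ε δ / 4` there; convergence of `f` excludes this for large `t`.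
  have hinc : Tendsto (fun t => f (t + δ / 2) - f t) atTop (𝓝 0) := by
    simpa using (hlim.comp (tendsto_atTop_add_const_right _ (δ / 2) tendsto_id)).sub hlim
  filter_upwards [hinc.eventually_lt_const (show 0 < ε * δ / 4 by positivity),
    eventually_ge_atTop 0] with t ht ht0
  have hlow := le_sub_of_ae_le_hasDerivAt (f := f) (c := w t - ε / 2)
    (show t ≤ t + δ / 2 by linarith)
    (absolutelyContinuousOnInterval_of_nonneg hf ht0 (by linarith)) (by
      filter_upwards [hder] with u hu hut
      obtain ⟨d, hd, hwd⟩ := hu (ht0.trans_lt hut.1)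
      refine ⟨d, hd, le_trans ?_ hwd⟩
      have := hwδ t ht0 u (ht0.trans hut.1.le) (by
        rw [Real.dist_eq, abs_sub_lt_iff]; constructor <;> linarith [hut.1, hut.2])
      rw [Real.dist_eq, abs_sub_lt_iff] at this
      linarith [this.1])
  have : (w t - ε / 2) * (δ / 2) < (ε / 2) * (δ / 2) := by nlinarith
  nlinarith

/-- **Barbalat's lemma** for absolutely continuous curves. -/
theorem tendsto_zero_of_hasDerivAt_of_tendsto [FiniteDimensional ℝ E] {f w : ℝ → E} {c : E}
    (hf : ∀ T : ℝ, 0 < T → AbsolutelyContinuousOnInterval f 0 T)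
    (hder : ∀ᵐ t : ℝ, 0 < t → HasDerivAt f (w t) t)
    (hw : UniformContinuousOn w (Ici 0)) (hlim : Tendsto f atTop (𝓝 c)) :
    Tendsto w atTop (𝓝 0) := by
  -- Using the one-sided bound for each coordinate functional and for its negative gives a two-sided
  -- bound.
  have key : ∀ φ : E →L[ℝ] ℝ, ∀ ε > 0, ∀ᶠ t in atTop, φ (w t) ≤ ε := fun φ ε hε =>
    eventually_le_of_tendsto_of_le_hasDerivAt (f := fun t => φ (f t))
      (fun T hT => absolutelyContinuousOnInterval_contDiff_comp (hf T hT) φ.contDiff)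
      (by
        filter_upwards [hder] with t ht ht0
        exact ⟨_, φ.hasFDerivAt.comp_hasDerivAt t (ht ht0), le_rfl⟩)
      (φ.uniformContinuous.comp_uniformContinuousOn hw)
      ((φ.continuous.tendsto c).comp hlim) hε
  let b := Module.finBasis ℝ E
  have hcoord : ∀ i, Tendsto (fun t => b.repr (w t) i) atTop (𝓝 0) := by
    intro i
    have h1 := key (LinearMap.toContinuousLinearMap (b.coord i))
    have h2 := key (-LinearMap.toContinuousLinearMap (b.coord i))
    rw [Metric.tendsto_nhds]
    intro ε hε
    filter_upwards [h1 (ε / 2) (by positivity), h2 (ε / 2) (by positivity)] with t h1 h2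
    simp at h1 h2
    rw [Real.dist_eq, abs_sub_lt_iff]
    constructor <;> linarith
  have := tendsto_finsetSum Finset.univ fun i _ => (hcoord i).smul_const (b i)
  simpa [b.sum_repr] using this

/-- Along a sequence of windows of fixed length, the increments of a curve whose velocity tends to
zero tend to zero. -/
theorem tendsto_window_of_hasDerivAt [FiniteDimensional ℝ E] {f w : ℝ → E} {t : ℕ → ℝ} {c : E}
    (hf : ∀ T : ℝ, 0 < T → AbsolutelyContinuousOnInterval f 0 T)
    (hder : ∀ᵐ t : ℝ, 0 < t → HasDerivAt f (w t) t) (hw : Tendsto w atTop (𝓝 0))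
    (ht : Tendsto t atTop atTop) (hlim : Tendsto (fun k => f (t k)) atTop (𝓝 c)) (T : ℝ) :
    Tendsto (fun k : ℕ × ℝ => f (t k.1 + k.2)) (atTop ×ˢ 𝓟 (Icc (-T) T)) (𝓝 c) := by
  suffices h : Tendsto (fun k : ℕ × ℝ => f (t k.1 + k.2) - f (t k.1))
      (atTop ×ˢ 𝓟 (Icc (-T) T)) (𝓝 0) by
    simpa using h.add (hlim.comp tendsto_fst)
  rcases lt_or_ge T 0 with hT | hT
  · simp [Icc_eq_empty (show ¬ -T ≤ T by linarith)]
  rw [Metric.tendsto_nhds]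
  intro ε hε
  rw [eventually_prod_principal_iff]
  have hsmall : ∀ᶠ u in atTop, ‖w u‖ < ε / (T + 1) := by
    have := (tendsto_zero_iff_norm_tendsto_zero.1 hw)
    exact this.eventually_lt_const (by positivity)
  obtain ⟨u₀, hu₀⟩ := eventually_atTop.1 hsmall
  filter_upwards [ht.eventually_ge_atTop (max u₀ 0 + T)] with k hk h hh
  have hge : ∀ a b, a ≤ b → b - a ≤ T → t k - T ≤ a → ‖f b - f a‖ < ε := by
    intro a b hab hba ha
    have h0 : max u₀ 0 ≤ a := by linarith
    have := norm_sub_le_of_ae_hasDerivAt (c := ε / (T + 1)) hab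
      (absolutelyContinuousOnInterval_of_nonneg hf ((le_max_right _ _).trans h0) hab) (by
        filter_upwards [hder] with u hu hut
        exact ⟨_, hu (((le_max_right _ _).trans h0).trans_lt hut.1),
          (hu₀ u (((le_max_left _ _).trans h0).trans hut.1.le)).le⟩)
    refine this.trans_lt ?_
    calc ε / (T + 1) * (b - a) ≤ ε / (T + 1) * T := by gcongr
      _ < ε / (T + 1) * (T + 1) := by gcongr; linarith
      _ = ε := by field_simp
  rw [dist_zero_right]
  rcases le_total 0 h with h0 | h0
  · exact hge _ _ (by linarith) (by linarith [hh.2]) (by linarith)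
  · rw [norm_sub_rev]
    exact hge _ _ (by linarith) (by linarith [hh.1]) (by linarith [hh.1])

/-- Limits of a bounded nonnegative solution of a scalar projected equation whose driving signal
is asymptotically constant are equilibria. -/
theorem projected_limit_complementary {f w : ℝ → ℝ} {t : ℕ → ℝ} {fl wl R : ℝ}
    (hf : ∀ T : ℝ, 0 < T → AbsolutelyContinuousOnInterval f 0 T)
    (hnonneg : ∀ u, 0 ≤ u → 0 ≤ f u) (hbdd : ∀ u, 0 ≤ u → f u ≤ R)
    (hder : ∀ᵐ u : ℝ, 0 < u → HasDerivAt f (if 0 < f u then w u else max 0 (w u)) u)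
    (ht : Tendsto t atTop atTop) (hlim : Tendsto (fun k => f (t k)) atTop (𝓝 fl))
    (hw : ∀ T : ℝ, Tendsto (fun k : ℕ × ℝ => w (t k.1 + k.2)) (atTop ×ˢ 𝓟 (Icc (-T) T)) (𝓝 wl)) :
    wl ≤ 0 ∧ (fl ≠ 0 → wl = 0) := by
  have hR : 0 ≤ R := (hnonneg 0 le_rfl).trans (hbdd 0 le_rfl)
  have hle : wl ≤ 0 := by
    by_contra! hpos
    -- Growth at rate `wl / 2` during time `T` amounts to `R + 1`, more than the range `[0, R]`
    -- allows.
    set T : ℝ := 2 * (R + 1) / wl with hT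
    have hT0 : 0 < T := by positivity
    have hev := (hw T).eventually_const_lt (show wl / 2 < wl by linarith)
    rw [eventually_prod_principal_iff] at hev
    obtain ⟨k, hk, hk0⟩ := (hev.and (ht.eventually_ge_atTop 0)).exists
    have := le_sub_of_ae_le_hasDerivAt (f := f) (c := wl / 2) (show t k ≤ t k + T by linarith)
      (absolutelyContinuousOnInterval_of_nonneg hf hk0 (by linarith)) (by
        filter_upwards [hder] with u hu hut
        refine ⟨_, hu (hk0.trans_lt hut.1), ?_⟩
        have := hk (u - t k) ⟨by linarith [hut.1], by linarith [hut.2]⟩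
        rw [add_sub_cancel] at this
        split_ifs
        · exact this.le
        · exact this.le.trans (le_max_right _ _))
    have h1 : wl / 2 * T = R + 1 := by rw [hT]; field_simp
    have := hbdd (t k + T) (by linarith)
    have := hnonneg (t k) hk0
    rw [add_sub_cancel_left] at *
    linarith
  refine ⟨hle, fun hfl => ?_⟩
  by_contra hne
  have hneg : wl < 0 := lt_of_le_of_ne hle hne
  have hflpos : 0 < fl := by
    refine lt_of_le_of_ne (ge_of_tendsto hlim ?_) (Ne.symm hfl)
    filter_upwards [ht.eventually_ge_atTop 0] with k hk using hnonneg _ hk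
  -- The same length, now for a window that ends at `t k`: decreasing at rate `-wl / 2` throughout
  -- it, `f` would have started above `R`.
  set T : ℝ := 2 * (R + 1) / (-wl) with hT
  have hT0 : 0 < T := div_pos (by positivity) (by linarith)
  have hev := (hw T).eventually_lt_const (show wl < wl / 2 by linarith)
  rw [eventually_prod_principal_iff] at hev
  obtain ⟨k, ⟨hk, hk0⟩, hkf⟩ :=
    ((hev.and (ht.eventually_ge_atTop T)).and (hlim.eventually_const_lt hflpos)).exists
  have hwin : ∀ u, t k - T ≤ u → u ≤ t k → w u < wl / 2 := by
    intro u h1 h2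
    have := hk (u - t k) ⟨by linarith, by linarith⟩
    rwa [add_sub_cancel] at this
  -- Both branches of the derivative are nonpositive on the window, so `f` is at least `f (t k) > 0`
  -- there. Hence the projection is inactive and the derivative is `w` itself.
  have hposwin : ∀ u, t k - T ≤ u → u ≤ t k → 0 < f u := by
    intro u h1 h2
    have := sub_le_of_ae_hasDerivAt_le (f := f) (c := 0) h2
      (absolutelyContinuousOnInterval_of_nonneg hf (by linarith) h2) (by
        filter_upwards [hder] with v hv hvt
        refine ⟨_, hv (by linarith [hvt.1]), ?_⟩
        have := hwin v (by linarith [hvt.1]) hvt.2.le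
        split_ifs
        · linarith
        · exact max_le le_rfl (by linarith))
    linarith
  have := sub_le_of_ae_hasDerivAt_le (f := f) (c := wl / 2) (show t k - T ≤ t k by linarith)
    (absolutelyContinuousOnInterval_of_nonneg hf (by linarith) (by linarith)) (by
      filter_upwards [hder] with v hv hvt
      refine ⟨_, hv (by linarith [hvt.1]), ?_⟩
      rw [if_pos (hposwin v hvt.1.le hvt.2.le)]
      exact (hwin v hvt.1.le hvt.2.le).le)
  have h1 : wl / 2 * T = -(R + 1) := by
    have : wl ≠ 0 := hneg.ne
    rw [hT]; field_simp
  have h2 := hbdd (t k - T) (by linarith)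
  rw [sub_sub_cancel, h1] at this
  linarith

end AbsolutelyContinuous

/-! ### Convex functions, monotone maps, quadratic forms -/

section Convex

variable {E : Type*} [NormedAddCommGroup E]

theorem convexOn_gradient_inequality [NormedSpace ℝ E] {f : E → ℝ} (hf : ConvexOn ℝ univ f)
    {f' : E →L[ℝ] ℝ} {x : E} (hx : HasFDerivAt f f' x) (y : E) : f x + f' (y - x) ≤ f y := by
  have hline : HasDerivAt (fun t : ℝ => AffineMap.lineMap x y t) (y - x) 0 := by
    exact AffineMap.hasDerivAt_lineMap
  have hconv : ConvexOn ℝ univ (fun t : ℝ => f (AffineMap.lineMap x y t)) := by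
    exact hf.comp_affineMap (AffineMap.lineMap (k := ℝ) x y)
  have hd : HasDerivAt (fun t : ℝ => f (AffineMap.lineMap x y t)) (f' (y - x)) 0 := by
    have : HasFDerivAt f f' (AffineMap.lineMap x y (0 : ℝ)) := by simpa using hx
    exact this.comp_hasDerivAt 0 hline
  have := hconv.le_slope_of_hasDerivAt (mem_univ _) (mem_univ _) one_pos hd
  simp [slope_def_field] at this
  simp
  linarith

/-- A directional derivative of a convex function is the infimum of its forward difference
quotients, each continuous in the base point, so it is upper semicontinuous. The direction `-v`
gives lower semicontinuity. -/
theorem continuous_fderiv_apply_of_convexOn [NormedSpace ℝ E] {f : E → ℝ}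
    (hf : ConvexOn ℝ univ f) (hd : Differentiable ℝ f) (v : E) :
    Continuous fun x => fderiv ℝ f x v := by
  have key : ∀ (v x₀ : E) (ε : ℝ), 0 < ε → ∀ᶠ x in 𝓝 x₀, fderiv ℝ f x v < fderiv ℝ f x₀ v + ε := by
    intro v x₀ ε hε
    have hline : HasDerivAt (fun t : ℝ => f (x₀ + t • v)) (fderiv ℝ f x₀ v) 0 := by
      have h1 : HasDerivAt (fun t : ℝ => x₀ + t • v) v 0 := by
        simpa using ((hasDerivAt_id (0 : ℝ)).smul_const v).const_add x₀
      have h2 : HasFDerivAt f (fderiv ℝ f x₀) (x₀ + (0 : ℝ) • v) := by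
        simpa using (hd x₀).hasFDerivAt
      exact h2.comp_hasDerivAt 0 h1
    have hslope := hline.tendsto_slope_zero_right
    simp only [zero_add, zero_smul, add_zero, smul_eq_mul] at hslope
    obtain ⟨t, ht, ht0⟩ := ((hslope.eventually_lt_const
      (show fderiv ℝ f x₀ v < fderiv ℝ f x₀ v + ε by linarith)).and self_mem_nhdsWithin).exists
    have hc : Continuous fun x => t⁻¹ * (f (x + t • v) - f x) := by
      have := hd.continuous
      fun_prop
    filter_upwards [hc.continuousAt.eventually_lt_const ht] with x hx
    refine lt_of_le_of_lt ?_ hx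
    have := convexOn_gradient_inequality hf (hd x).hasFDerivAt (x + t • v)
    rw [add_sub_cancel_left, map_smul, smul_eq_mul] at this
    rw [le_inv_mul_iff₀ ht0]
    linarith
  rw [continuous_iff_continuousAt]
  intro x₀
  rw [ContinuousAt, Metric.tendsto_nhds]
  intro ε hε
  filter_upwards [key v x₀ ε hε, key (-v) x₀ ε hε] with x h1 h2
  rw [map_neg, map_neg] at h2
  rw [Real.dist_eq, abs_sub_lt_iff]
  constructor <;> linarith

/-- A monotone map whose components along an orthonormal basis are continuous along the
corresponding basis directions is continuous. -/
theorem continuous_of_monotone_of_directional [InnerProductSpace ℝ E] {J : Type*} [Fintype J]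
    (b : OrthonormalBasis J ℝ E) {F : E → E}
    (hF : ∀ x y, 0 ≤ ⟪x - y, F x - F y⟫_ℝ)
    (hdir : ∀ x j, ContinuousAt (fun t : ℝ => ⟪b j, F (x + t • b j)⟫_ℝ) 0) :
    Continuous F := by
  -- Monotonicity between `x` and `x₀ + w`: up to an error proportional to `‖x - x₀‖`, the component
  -- of `F x` along `w` is bounded by that of `F y` at a point `y` that does not depend on `x`.
  have hstep : ∀ (x₀ x y w : E), y = x₀ + w →
      ⟪w, F x⟫_ℝ ≤ ⟪w, F y⟫_ℝ + (‖F x‖ + ‖F y‖) * ‖x - x₀‖ := by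
    rintro x₀ x y w rfl
    have h := hF x (x₀ + w)
    have h1 : ⟪x - x₀, F x - F (x₀ + w)⟫_ℝ ≤ (‖F x‖ + ‖F (x₀ + w)‖) * ‖x - x₀‖ := by
      refine (real_inner_le_norm _ _).trans ?_
      rw [mul_comm]
      gcongr
      exact norm_sub_le _ _
    have h2 : ⟪x - (x₀ + w), F x - F (x₀ + w)⟫_ℝ
        = ⟪x - x₀, F x - F (x₀ + w)⟫_ℝ - (⟪w, F x⟫_ℝ - ⟪w, F (x₀ + w)⟫_ℝ) := by
      rw [← sub_sub, inner_sub_left, inner_sub_right w]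
    linarith
  have hbdd : ∀ x₀, ∃ C, ∀ᶠ x in 𝓝 x₀, ‖F x‖ ≤ C := by
    intro x₀
    set D : ℝ := ∑ j, (‖F (x₀ + b j)‖ + ‖F (x₀ + (-b j))‖) with hD
    have hDnn : 0 ≤ D := by positivity
    set N : ℝ := (Fintype.card J : ℝ) with hN
    have hNnn : 0 ≤ N := by positivity
    -- Testing with `w = ±b j` yields `‖F x‖ ≤ N (2 D + ‖F x‖ ‖x - x₀‖)`. Near `x₀` one has `N ‖x -
    -- x₀‖ ≤ 1/2`, so half of `‖F x‖` is absorbed on the left, which doubles the constant.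
    refine ⟨2 * (N * (D * 2)), ?_⟩
    have hnear : ∀ᶠ x in 𝓝 x₀, ‖x - x₀‖ < 1 / (2 * N + 1) := by
      have : Tendsto (fun x => ‖x - x₀‖) (𝓝 x₀) (𝓝 0) := by
        have : Continuous fun x => ‖x - x₀‖ := by fun_prop
        simpa using this.tendsto x₀
      exact this.eventually_lt_const (by positivity)
    filter_upwards [hnear] with x hx
    have hx1 : ‖x - x₀‖ ≤ 1 := hx.le.trans (by
      rw [div_le_one (by positivity)]; linarith)
    have hcoord : ∀ j, |⟪b j, F x⟫_ℝ| ≤ D * 2 + ‖F x‖ * ‖x - x₀‖ := by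
      intro j
      have hsum : ‖F (x₀ + b j)‖ + ‖F (x₀ + (-b j))‖ ≤ D :=
        Finset.single_le_sum (f := fun j => ‖F (x₀ + b j)‖ + ‖F (x₀ + (-b j))‖)
          (fun _ _ => by positivity) (Finset.mem_univ j)
      have hw : ∀ w, ‖w‖ = 1 → ‖F (x₀ + w)‖ ≤ D → ⟪w, F x⟫_ℝ ≤ D * 2 + ‖F x‖ * ‖x - x₀‖ := by
        intro w hw1 hwD
        have h1 := hstep x₀ x _ w rfl
        have h2 := real_inner_le_norm w (F (x₀ + w))
        rw [hw1, one_mul] at h2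
        have h3 : ‖F (x₀ + w)‖ * ‖x - x₀‖ ≤ D * 1 := by gcongr
        nlinarith
      rw [abs_le]
      have h1 := hw (b j) (b.norm_eq_one j) (by linarith [norm_nonneg (F (x₀ + (-b j)))])
      have h2 := hw (-b j) (by rw [norm_neg, b.norm_eq_one j])
        (by linarith [norm_nonneg (F (x₀ + b j))])
      rw [inner_neg_left] at h2
      constructor <;> linarith
    have hnorm : ‖F x‖ ≤ N * (D * 2 + ‖F x‖ * ‖x - x₀‖) := by
      calc ‖F x‖ = ‖∑ j, ⟪b j, F x⟫_ℝ • b j‖ := by rw [b.sum_repr']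
        _ ≤ ∑ j, ‖⟪b j, F x⟫_ℝ • b j‖ := norm_sum_le _ _
        _ ≤ ∑ _j : J, (D * 2 + ‖F x‖ * ‖x - x₀‖) := by
            refine Finset.sum_le_sum fun j _ => ?_
            rw [norm_smul, b.norm_eq_one j, mul_one]
            exact hcoord j
        _ = N * (D * 2 + ‖F x‖ * ‖x - x₀‖) := by simp [hN]; ring
    have h4 : N * ‖x - x₀‖ ≤ 1 / 2 := by
      calc N * ‖x - x₀‖ ≤ N * (1 / (2 * N + 1)) := by gcongr
        _ ≤ 1 / 2 := by rw [mul_one_div, div_le_div_iff₀ (by positivity) two_pos]; linarith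
    have h5 : N * ‖x - x₀‖ * ‖F x‖ ≤ 1 / 2 * ‖F x‖ := by gcongr
    nlinarith
  -- First fix a small step `t` along `σ b j`, where directional continuity controls `F`; then let
  -- `x → x₀`. Local boundedness kills the error in `hstep` even after division by `t`.
  have key : ∀ x₀ j (σ : ℝ), (σ = 1 ∨ σ = -1) → ∀ ε > 0, ∀ᶠ x in 𝓝 x₀,
      σ * ⟪b j, F x⟫_ℝ < σ * ⟪b j, F x₀⟫_ℝ + ε := by
    intro x₀ j σ hσ ε hε
    have hcont : Tendsto (fun t : ℝ => σ * ⟪b j, F (x₀ + (σ * t) • b j)⟫_ℝ) (𝓝[>] 0)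
        (𝓝 (σ * ⟪b j, F x₀⟫_ℝ)) := by
      have h1 : Tendsto (fun t : ℝ => σ * t) (𝓝[>] 0) (𝓝 0) := by
        have : Continuous fun t : ℝ => σ * t := by fun_prop
        simpa using (this.tendsto 0).mono_left nhdsWithin_le_nhds
      have := (hdir x₀ j).tendsto.comp h1
      simp only [zero_smul, add_zero] at this
      exact this.const_mul σ
    obtain ⟨t, ht, ht0⟩ := ((hcont.eventually_lt_const
      (show _ < σ * ⟪b j, F x₀⟫_ℝ + ε / 2 by linarith)).and self_mem_nhdsWithin).exists
    have ht0 : 0 < t := ht0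
    obtain ⟨C, hC⟩ := hbdd x₀
    set y := x₀ + (σ * t) • b j with hy
    have hnear : ∀ᶠ x in 𝓝 x₀, (C + ‖F y‖) * ‖x - x₀‖ < ε / 2 * t := by
      have : Tendsto (fun x => (C + ‖F y‖) * ‖x - x₀‖) (𝓝 x₀) (𝓝 0) := by
        have : Continuous fun x => (C + ‖F y‖) * ‖x - x₀‖ := by fun_prop
        simpa using this.tendsto x₀
      exact this.eventually_lt_const (by positivity)
    filter_upwards [hC, hnear] with x hxC hx
    have h1 := hstep x₀ x y ((σ * t) • b j) hy
    rw [real_inner_smul_left, real_inner_smul_left] at h1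
    have h2 : (‖F x‖ + ‖F y‖) * ‖x - x₀‖ ≤ (C + ‖F y‖) * ‖x - x₀‖ := by gcongr
    have h3 : t * (σ * ⟪b j, F x⟫_ℝ) < t * (σ * ⟪b j, F y⟫_ℝ + ε / 2) := by nlinarith
    have h4 := lt_of_mul_lt_mul_left h3 ht0.le
    linarith
  have hco : ∀ j, Continuous fun x => ⟪b j, F x⟫_ℝ := by
    intro j
    rw [continuous_iff_continuousAt]
    intro x₀
    rw [ContinuousAt, Metric.tendsto_nhds]
    intro ε hε
    filter_upwards [key x₀ j 1 (Or.inl rfl) ε hε, key x₀ j (-1) (Or.inr rfl) ε hε] with x h1 h2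
    rw [Real.dist_eq, abs_sub_lt_iff]
    constructor <;> linarith
  have : F = fun x => ∑ j, ⟪b j, F x⟫_ℝ • b j := by
    funext x
    rw [b.sum_repr']
  rw [this]
  exact continuous_finsetSum _ fun j _ => (hco j).smul continuous_const

theorem exists_coercive_of_inner_pos [InnerProductSpace ℝ E] [FiniteDimensional ℝ E]
    (A : E →L[ℝ] E) (hA : ∀ v, v ≠ 0 → 0 < ⟪v, A v⟫_ℝ) :
    ∃ c > 0, ∀ v, c * ‖v‖ ^ 2 ≤ ⟪v, A v⟫_ℝ := by
  have hcont : Continuous fun v => ⟪v, A v⟫_ℝ := by fun_prop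
  rcases (Metric.sphere (0 : E) 1).eq_empty_or_nonempty with he | hne
  -- An empty unit sphere means that the space is trivial, so any constant will do.
  · refine ⟨1, one_pos, fun v => ?_⟩
    by_cases hv : v = 0
    · simp [hv]
    · have : ‖v‖⁻¹ • v ∈ Metric.sphere (0 : E) 1 := by
        simp [norm_smul, hv]
      simp [he] at this
  · obtain ⟨u, hu, hmin⟩ := (isCompact_sphere (0 : E) 1).exists_isMinOn hne hcont.continuousOn
    have hu0 : u ≠ 0 := by
      rintro rfl
      simp at hu
    refine ⟨⟪u, A u⟫_ℝ, hA u hu0, fun v => ?_⟩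
    by_cases hv : v = 0
    · simp [hv]
    · have hv' : 0 < ‖v‖ := norm_pos_iff.2 hv
      have hmem : ‖v‖⁻¹ • v ∈ Metric.sphere (0 : E) 1 := by
        simp [norm_smul, hv]
      have := isMinOn_iff.1 hmin _ hmem
      rw [map_smul, real_inner_smul_left, real_inner_smul_right] at this
      calc ⟪u, A u⟫_ℝ * ‖v‖ ^ 2 ≤ (‖v‖⁻¹ * (‖v‖⁻¹ * ⟪v, A v⟫_ℝ)) * ‖v‖ ^ 2 := by gcongr
        _ = ⟪v, A v⟫_ℝ := by field_simp

/-- A `C¹` function that vanishes at a point and dominates a multiple of the squared distance to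
it is a storage function centred there. -/
theorem isStorage_of_le {X : Type*} [NormedAddCommGroup X] [NormedSpace ℝ X]
    [FiniteDimensional ℝ X] {V : X → ℝ} {x₀ : X} {c : ℝ} (hV : ContDiff ℝ 1 V) (h0 : V x₀ = 0)
    (hc : 0 < c) (hle : ∀ x, c * ‖x - x₀‖ ^ 2 ≤ V x) : IsStorage V x₀ := by
  have : ProperSpace X := FiniteDimensional.proper_real X
  refine ⟨hV, h0, fun x hx => ?_, ?_⟩
  · have : 0 < ‖x - x₀‖ := norm_pos_iff.2 (sub_ne_zero.2 hx)
    exact lt_of_lt_of_le (by positivity) (hle x)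
  · refine tendsto_atTop_mono hle ?_
    refine Tendsto.const_mul_atTop hc ((tendsto_pow_atTop two_ne_zero).comp ?_)
    simpa [dist_eq_norm] using tendsto_dist_right_cocompact_atTop x₀

end Convex

/-! ### The projection onto the orthant -/

section Orthant

variable {ι : Type*} {d : ι → ℕ}

theorem blockPos_apply (v : BlockVec d) (i : ι) (k : Fin (d i)) :
    blockPos v i k = max 0 (v i k) := rfl

theorem blockPos_mem_blockOrthant (v : BlockVec d) : blockPos v ∈ blockOrthant d :=
  fun _ _ => le_max_left _ _

theorem blockPos_of_mem_blockOrthant {v : BlockVec d} (hv : v ∈ blockOrthant d) :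
    blockPos v = v := by
  ext i k
  exact max_eq_right (hv i k)

theorem continuous_blockVec_apply (i : ι) (k : Fin (d i)) :
    Continuous fun v : BlockVec d => v i k := by
  fun_prop

theorem continuous_blockPos : Continuous (blockPos : BlockVec d → BlockVec d) := by
  unfold blockPos
  refine (PiLp.continuous_toLp 2 _).comp (continuous_pi fun i => ?_)
  refine (PiLp.continuous_toLp 2 _).comp (continuous_pi fun k => ?_)
  exact continuous_const.max (continuous_blockVec_apply i k)

variable [Fintype ι]

theorem blockVec_inner (v w : BlockVec d) : ⟪v, w⟫_ℝ = ∑ i, ∑ k, v i k * w i k := by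
  simp [PiLp.inner_apply, mul_comm]

theorem blockVec_norm_sq (v : BlockVec d) : ‖v‖ ^ 2 = ∑ i, ∑ k, v i k ^ 2 := by
  rw [← real_inner_self_eq_norm_sq, blockVec_inner]
  simp [sq]

/-- Nearest points of the orthant are unique: they are the entrywise positive parts. -/
theorem proj_blockOrthant (x : BlockVec d) : proj (blockOrthant d) x = blockPos x := by
  -- The obtuse-angle inequality gives both existence and uniqueness of the minimizer, so the choice
  -- made by `proj` is determined.
  have hkey : ∀ y ∈ blockOrthant d, ‖blockPos x - x‖ ^ 2 + ‖y - blockPos x‖ ^ 2 ≤ ‖y - x‖ ^ 2 := by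
    intro y hy
    simp only [blockVec_norm_sq, ← Finset.sum_add_distrib]
    refine Finset.sum_le_sum fun i _ => Finset.sum_le_sum fun k _ => ?_
    simp only [PiLp.sub_apply, blockPos_apply]
    have := hy i k
    rcases le_total 0 (x i k) with h | h
    · rw [max_eq_right h]; nlinarith
    · rw [max_eq_left h]; nlinarith
  have hex : ∃ p, p ∈ blockOrthant d ∧ ∀ y ∈ blockOrthant d, ‖p - x‖ ≤ ‖y - x‖ := by
    refine ⟨blockPos x, blockPos_mem_blockOrthant x, fun y hy => ?_⟩
    have := hkey y hy
    exact le_of_sq_le_sq (by nlinarith [sq_nonneg ‖y - blockPos x‖]) (norm_nonneg _)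
  obtain ⟨hmem, hmin⟩ := Classical.epsilon_spec hex
  change proj (blockOrthant d) x ∈ _ at hmem
  have h1 := hkey _ hmem
  have h2 : ‖proj (blockOrthant d) x - x‖ ≤ ‖blockPos x - x‖ :=
    hmin _ (blockPos_mem_blockOrthant x)
  have h3 : ‖proj (blockOrthant d) x - x‖ ^ 2 ≤ ‖blockPos x - x‖ ^ 2 := by gcongr
  have h4 : ‖proj (blockOrthant d) x - blockPos x‖ ^ 2 = 0 :=
    le_antisymm (by linarith) (sq_nonneg _)
  exact sub_eq_zero.1 (norm_eq_zero.1 (pow_eq_zero_iff two_ne_zero |>.1 h4))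

/-- For small `h > 0` positive entries stay positive and are not clipped, while at zero entries the
positive part is homogeneous in `h`. The difference quotient is therefore eventually constant. -/
theorem projOp_blockOrthant_apply {x : BlockVec d} (hx : x ∈ blockOrthant d) (v : BlockVec d)
    (i : ι) (k : Fin (d i)) :
    projOp (blockOrthant d) x v i k = if 0 < x i k then v i k else max 0 (v i k) := by
  set w : BlockVec d := WithLp.toLp 2 fun i => WithLp.toLp 2 fun k =>
    if 0 < x i k then v i k else max 0 (v i k) with hw
  have hlim : Tendsto (fun h : ℝ => h⁻¹ • (proj (blockOrthant d) (x + h • v) - x)) (𝓝[>] 0)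
      (𝓝 w) := by
    refine tendsto_const_nhds.congr' ?_
    have hpos : ∀ᶠ h in 𝓝[>] (0 : ℝ), ∀ i k, 0 < x i k → 0 < x i k + h * v i k := by
      rw [eventually_all]
      intro i
      rw [eventually_all]
      intro k
      by_cases hik : 0 < x i k
      · have : Continuous fun h : ℝ => x i k + h * v i k := by fun_prop
        have := (this.tendsto 0).mono_left (nhdsWithin_le_nhds (s := Ioi 0))
        filter_upwards [this.eventually_const_lt (by simpa using hik)] with h hh _ using hh
      · exact Eventually.of_forall fun h h' => absurd h' hik
    filter_upwards [hpos, self_mem_nhdsWithin] with h hh h0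
    have h0 : 0 < h := h0
    rw [proj_blockOrthant]
    ext i k
    simp only [hw, PiLp.smul_apply, PiLp.sub_apply, blockPos_apply, PiLp.add_apply, smul_eq_mul]
    split_ifs with hik
    · rw [max_eq_right (hh i k hik).le]
      field_simp
      ring
    · have : x i k = 0 := le_antisymm (not_lt.1 hik) (hx i k)
      rw [this, zero_add, sub_zero]
      rcases le_total 0 (v i k) with hv | hv
      · rw [max_eq_right hv, max_eq_right (by positivity)]
        field_simp
      · rw [max_eq_left hv, max_eq_left (by nlinarith), mul_zero]
  have : projOp (blockOrthant d) x v = w := hlim.limUnder_eq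
  rw [this]

/-- The projection only raises entries of `v`, and only where `x` is zero, that is, where `x - y ≤
0`. With `y = 0` the altered entries have weight zero, which gives the equality in `inner_projOp`.
-/
theorem inner_sub_projOp_le {x y : BlockVec d} (hx : x ∈ blockOrthant d) (hy : y ∈ blockOrthant d)
    (v : BlockVec d) : ⟪x - y, projOp (blockOrthant d) x v⟫_ℝ ≤ ⟪x - y, v⟫_ℝ := by
  rw [blockVec_inner, blockVec_inner]
  refine Finset.sum_le_sum fun i _ => Finset.sum_le_sum fun k _ => ?_
  rw [projOp_blockOrthant_apply hx]
  split_ifs with h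
  · exact le_rfl
  · have : x i k = 0 := le_antisymm (not_lt.1 h) (hx i k)
    rw [PiLp.sub_apply, PiLp.sub_apply, this]
    have := hy i k
    have := le_max_right 0 (v i k)
    nlinarith

theorem inner_projOp {x : BlockVec d} (hx : x ∈ blockOrthant d) (v : BlockVec d) :
    ⟪x, projOp (blockOrthant d) x v⟫_ℝ = ⟪x, v⟫_ℝ := by
  rw [blockVec_inner, blockVec_inner]
  refine Finset.sum_congr rfl fun i _ => Finset.sum_congr rfl fun k _ => ?_
  rw [projOp_blockOrthant_apply hx]
  split_ifs with h
  · rfl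
  · have : x i k = 0 := le_antisymm (not_lt.1 h) (hx i k)
    simp [this]

theorem norm_projOp_le {x : BlockVec d} (hx : x ∈ blockOrthant d) (v : BlockVec d) :
    ‖projOp (blockOrthant d) x v‖ ≤ ‖v‖ := by
  refine le_of_sq_le_sq ?_ (norm_nonneg v)
  rw [blockVec_norm_sq, blockVec_norm_sq]
  refine Finset.sum_le_sum fun i _ => Finset.sum_le_sum fun k _ => ?_
  rw [projOp_blockOrthant_apply hx]
  split_ifs with h
  · exact le_rfl
  · rcases le_total 0 (v i k) with hv | hv
    · rw [max_eq_right hv]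
    · rw [max_eq_left hv]
      nlinarith

theorem projOp_eq_zero_iff {x : BlockVec d} (hx : x ∈ blockOrthant d) (v : BlockVec d) :
    projOp (blockOrthant d) x v = 0 ↔ ∀ i k, v i k ≤ 0 ∧ (x i k ≠ 0 → v i k = 0) := by
  constructor
  · intro h i k
    have h1 := projOp_blockOrthant_apply hx v i k
    rw [h] at h1
    simp only [PiLp.zero_apply] at h1
    split_ifs at h1 with hik
    · exact ⟨h1.symm.le, fun _ => h1.symm⟩
    · exact ⟨by rw [h1]; exact le_max_right _ _,
        fun hne => absurd (lt_of_le_of_ne (hx i k) hne.symm) hik⟩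
  · intro h
    ext i k
    rw [projOp_blockOrthant_apply hx]
    split_ifs with hik
    · exact (h i k).2 hik.ne'
    · exact max_eq_left (h i k).1

end Orthant

/-! ### Block diagonal matrices -/

section BlockDiagonal

variable {ι : Type*} {d e : ι → ℕ}

/-- Multiplication by a block diagonal matrix as a linear map. -/
def blockMulLin (M : ∀ i, Matrix (Fin (d i)) (Fin (e i)) ℝ) : BlockVec e →ₗ[ℝ] BlockVec d where
  toFun := blockMul M
  map_add' v w := by
    ext i k
    simp [blockMul, Matrix.mulVec_add]
  map_smul' c v := by
    ext i k
    simp [blockMul, Matrix.mulVec_smul]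

/-- Multiplication by a block diagonal matrix as a continuous linear map. -/
noncomputable def blockMulCLM [Fintype ι] (M : ∀ i, Matrix (Fin (d i)) (Fin (e i)) ℝ) :
    BlockVec e →L[ℝ] BlockVec d :=
  LinearMap.toContinuousLinearMap (blockMulLin M)

variable [Fintype ι]

theorem blockMulCLM_apply (M : ∀ i, Matrix (Fin (d i)) (Fin (e i)) ℝ) (v : BlockVec e) :
    blockMulCLM M v = blockMul M v := rfl

theorem blockMulCLM_apply_apply (M : ∀ i, Matrix (Fin (d i)) (Fin (e i)) ℝ) (v : BlockVec e)
    (i : ι) (k : Fin (d i)) : blockMulCLM M v i k = ∑ l, M i k l * v i l := rfl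

theorem blockMulCLM_injective {M : ∀ i, Matrix (Fin (d i)) (Fin (e i)) ℝ}
    (hM : ∀ i, Function.Injective (M i).mulVec) : Function.Injective (blockMulCLM M) := by
  intro v w h
  have h1 : ∀ i, (v i).ofLp = (w i).ofLp := fun i => hM i (by
    have := congrArg (fun u : BlockVec d => (u i).ofLp) h
    exact this)
  ext i k
  rw [h1]

theorem inner_blockMulCLM (M : ∀ i, Matrix (Fin (d i)) (Fin (e i)) ℝ) (v : BlockVec d)
    (w : BlockVec e) : ⟪v, blockMulCLM M w⟫_ℝ = ∑ i, (v i).ofLp ⬝ᵥ (M i *ᵥ (w i).ofLp) := by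
  rw [blockVec_inner]
  rfl

theorem blockQuadForm_eq_inner (P : ∀ i, Matrix (Fin (d i)) (Fin (d i)) ℝ) (v : BlockVec d) :
    blockQuadForm P v = ⟪v, blockMulCLM P v⟫_ℝ := by
  rw [inner_blockMulCLM]
  rfl

theorem inner_blockMulCLM_transpose (M : ∀ i, Matrix (Fin (d i)) (Fin (e i)) ℝ) (v : BlockVec d)
    (w : BlockVec e) : ⟪v, blockMulCLM M w⟫_ℝ = ⟪w, blockMulCLM (fun i => (M i)ᵀ) v⟫_ℝ := by
  rw [inner_blockMulCLM, inner_blockMulCLM]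
  refine Finset.sum_congr rfl fun i _ => ?_
  rw [Matrix.dotProduct_mulVec, ← Matrix.mulVec_transpose, dotProduct_comm]

theorem inner_blockMulCLM_pos {M : ∀ i, Matrix (Fin (d i)) (Fin (d i)) ℝ}
    (hM : ∀ i (v : Vec (d i)), v ≠ 0 → 0 < quadForm (M i) v) (v : BlockVec d) (hv : v ≠ 0) :
    0 < ⟪v, blockMulCLM M v⟫_ℝ := by
  rw [inner_blockMulCLM]
  have hnn : ∀ i (v : Vec (d i)), 0 ≤ quadForm (M i) v := by
    intro i v
    by_cases hv : v = 0
    · simp [hv, quadForm]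
    · exact (hM i v hv).le
  obtain ⟨i, hi⟩ : ∃ i, v i ≠ 0 := by
    by_contra! h
    exact hv (by ext i k; rw [h i]; rfl)
  exact Finset.sum_pos' (fun i _ => hnn i (v i)) ⟨i, Finset.mem_univ i, hM i _ hi⟩

end BlockDiagonal

/-! ### The Laplacian -/

section Laplacian

theorem IsWeightedAdjacency.nonneg {ι : Type*} {Gc : SimpleGraph ι} {a : Matrix ι ι ℝ}
    (ha : IsWeightedAdjacency Gc a) (i j : ι) : 0 ≤ a i j := by
  by_cases h : Gc.Adj i j
  · exact (ha.2.1 i j h).le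
  · exact (ha.2.2 i j h).ge

variable {ι : Type*} [Fintype ι] [DecidableEq ι] {m : ℕ}

theorem lapMul_apply (a : Matrix ι ι ℝ) (v : AgentVec ι m) (i : ι) :
    lapMul a v i = ∑ j, a i j • (v i - v j) := by
  change ∑ j, laplacian a i j • v j = _
  simp only [laplacian, Matrix.sub_apply, Matrix.diagonal_apply, sub_smul, smul_sub, ite_smul,
    zero_smul, Finset.sum_sub_distrib, Finset.sum_ite_eq, Finset.mem_univ, if_true, Finset.sum_smul]

/-- The action of the Laplacian as a linear map. -/
def lapLin (a : Matrix ι ι ℝ) : AgentVec ι m →ₗ[ℝ] AgentVec ι m where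
  toFun := lapMul a
  map_add' v w := by
    ext i k
    simp [lapMul_apply, ← Finset.sum_add_distrib]
    exact Finset.sum_congr rfl fun j _ => by ring
  map_smul' c v := by
    ext i k
    simp [lapMul_apply, Finset.mul_sum]
    exact Finset.sum_congr rfl fun j _ => by ring

/-- The action of the Laplacian as a continuous linear map. -/
noncomputable def lapCLM (a : Matrix ι ι ℝ) : AgentVec ι m →L[ℝ] AgentVec ι m :=
  LinearMap.toContinuousLinearMap (lapLin a)

theorem two_mul_inner_lapMul {a : Matrix ι ι ℝ} (ha : ∀ i j, a i j = a j i) (v w : AgentVec ι m) :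
    2 * ⟪v, lapMul a w⟫_ℝ = ∑ i, ∑ j, a i j * ⟪v i - v j, w i - w j⟫_ℝ := by
  have h1 : ⟪v, lapMul a w⟫_ℝ = ∑ i, ∑ j, a i j * ⟪v i, w i - w j⟫_ℝ := by
    rw [PiLp.inner_apply]
    simp only [lapMul_apply, inner_sum, real_inner_smul_right]
  have h2 : ⟪v, lapMul a w⟫_ℝ = ∑ i, ∑ j, a i j * ⟪v j, w j - w i⟫_ℝ := by
    rw [h1, Finset.sum_comm]
    exact Finset.sum_congr rfl fun i _ => Finset.sum_congr rfl fun j _ => by rw [ha]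
  rw [two_mul]
  nth_rewrite 1 [h1]
  rw [h2, ← Finset.sum_add_distrib]
  refine Finset.sum_congr rfl fun i _ => ?_
  rw [← Finset.sum_add_distrib]
  refine Finset.sum_congr rfl fun j _ => ?_
  rw [inner_sub_left, ← neg_sub (w j) (w i), inner_neg_right, inner_neg_right]
  ring

theorem inner_lapMul_comm {a : Matrix ι ι ℝ} (ha : ∀ i j, a i j = a j i) (v w : AgentVec ι m) :
    ⟪v, lapMul a w⟫_ℝ = ⟪w, lapMul a v⟫_ℝ := by
  have h1 := two_mul_inner_lapMul ha v w
  have : ∑ i, ∑ j, a i j * ⟪v i - v j, w i - w j⟫_ℝ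
      = ∑ i, ∑ j, a i j * ⟪w i - w j, v i - v j⟫_ℝ :=
    Finset.sum_congr rfl fun i _ => Finset.sum_congr rfl fun j _ => by rw [real_inner_comm]
  have h2 := two_mul_inner_lapMul ha w v
  linarith

theorem inner_lapMul_self_nonneg {a : Matrix ι ι ℝ} {Gc : SimpleGraph ι}
    (ha : IsWeightedAdjacency Gc a) (v : AgentVec ι m) : 0 ≤ ⟪v, lapMul a v⟫_ℝ := by
  have h1 := two_mul_inner_lapMul ha.1 v v
  have : 0 ≤ ∑ i, ∑ j, a i j * ⟪v i - v j, v i - v j⟫_ℝ :=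
    Finset.sum_nonneg fun i _ => Finset.sum_nonneg fun j _ =>
      mul_nonneg (ha.nonneg i j) real_inner_self_nonneg
  linarith

theorem sum_lapMul {a : Matrix ι ι ℝ} (ha : ∀ i j, a i j = a j i) (v : AgentVec ι m) :
    ∑ i, lapMul a v i = 0 := by
  simp only [lapMul_apply]
  have : ∑ i, ∑ j, a i j • (v i - v j) = -∑ i, ∑ j, a i j • (v i - v j) := by
    conv_lhs => rw [Finset.sum_comm]
    simp only [← Finset.sum_neg_distrib]
    refine Finset.sum_congr rfl fun i _ => Finset.sum_congr rfl fun j _ => ?_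
    rw [ha, ← smul_neg, neg_sub]
  have h2 : (2 : ℝ) • ∑ i, ∑ j, a i j • (v i - v j) = 0 := by
    rw [two_smul]
    nth_rewrite 2 [this]
    exact add_neg_cancel _
  exact (smul_eq_zero.1 h2).resolve_left two_ne_zero

theorem lapMul_const (a : Matrix ι ι ℝ) {v : AgentVec ι m} (hv : ∀ i j, v i = v j) :
    lapMul a v = 0 := by
  ext i k
  rw [lapMul_apply]
  simp [sub_eq_zero.2 (hv i _)]

/-- The quadratic form is a sum of nonnegative edge terms, so it vanishes only if `v` agrees across
every edge; a walk carries the equality from `i` to `j`. -/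
theorem eq_of_lapMul_eq_zero {a : Matrix ι ι ℝ} {Gc : SimpleGraph ι}
    (ha : IsWeightedAdjacency Gc a) (hGc : Gc.Connected) {v : AgentVec ι m}
    (hv : lapMul a v = 0) (i j : ι) : v i = v j := by
  have hnn : ∀ i j, 0 ≤ a i j * ⟪v i - v j, v i - v j⟫_ℝ := fun i j =>
    mul_nonneg (ha.nonneg i j) real_inner_self_nonneg
  have hsum := two_mul_inner_lapMul ha.1 v v
  rw [hv, inner_zero_right, mul_zero, eq_comm,
    Finset.sum_eq_zero_iff_of_nonneg fun i _ => Finset.sum_nonneg fun j _ => hnn i j] at hsum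
  have hadj : ∀ i j, Gc.Adj i j → v i = v j := by
    intro i j hij
    have h1 := (Finset.sum_eq_zero_iff_of_nonneg fun j _ => hnn i j).1
      (hsum i (Finset.mem_univ i)) j (Finset.mem_univ j)
    rcases mul_eq_zero.1 h1 with h | h
    · exact absurd h (ha.2.1 i j hij).ne'
    · exact sub_eq_zero.1 (inner_self_eq_zero.1 h)
  obtain ⟨p⟩ := hGc.preconnected i j
  induction p with
  | nil => rfl
  | cons h _ ih => exact (hadj _ _ h).trans ih

/-- The range of a symmetric operator is the orthogonal complement of its kernel, and on a connected
graph the kernel consists of consensus vectors, to which every vector with zero block sum is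
orthogonal. -/
theorem exists_lapMul_eq {a : Matrix ι ι ℝ} {Gc : SimpleGraph ι}
    (ha : IsWeightedAdjacency Gc a) (hGc : Gc.Connected) {v : AgentVec ι m}
    (hv : ∑ i, v i = 0) : ∃ z, lapMul a z = v := by
  have hsymm : (lapLin (m := m) a).IsSymmetric := fun x y => by
    rw [real_inner_comm]
    exact inner_lapMul_comm ha.1 y x
  have hmem : v ∈ (LinearMap.range (lapLin (m := m) a))ᗮᗮ := by
    rw [hsymm.orthogonal_range, Submodule.mem_orthogonal]
    intro u hu
    have hu : lapMul a u = 0 := hu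
    have hcons := eq_of_lapMul_eq_zero ha hGc hu
    obtain ⟨i₀⟩ := hGc.nonempty
    rw [PiLp.inner_apply]
    calc ∑ i, ⟪u i, v i⟫_ℝ = ∑ i, ⟪u i₀, v i⟫_ℝ :=
          Finset.sum_congr rfl fun i _ => by rw [hcons i i₀]
      _ = 0 := by rw [← inner_sum, hv, inner_zero_right]
  rw [Submodule.orthogonal_orthogonal] at hmem
  obtain ⟨z, hz⟩ := hmem
  exact ⟨z, hz⟩

end Laplacian

/-! ### Strictly passive linear systems -/

section LinearSystems

theorem hasFDerivAt_half_inner {E : Type*} [NormedAddCommGroup E] [InnerProductSpace ℝ E]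
    (A : E →L[ℝ] E) (hA : ∀ u v, ⟪u, A v⟫_ℝ = ⟪v, A u⟫_ℝ) (x : E) :
    HasFDerivAt (fun x => (1 / 2) * ⟪x, A x⟫_ℝ) (innerSL ℝ (A x)) x := by
  have := ((hasFDerivAt_id x).inner ℝ A.hasFDerivAt).const_mul (1 / 2 : ℝ)
  refine this.congr_fderiv ?_
  ext v
  simp [fderivInnerCLM_apply]
  have h1 := hA x v
  have h2 := real_inner_comm v (A x)
  linarith

/-- The easy half of the Kalman–Yakubovich–Popov lemma. Zero input gives the first condition. The
dissipation inequality is affine in the input and holds for all inputs, so its linear part vanishes,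
which is `P B = Cᵀ`. -/
theorem ltiSystem_passivity_conditions {d e : ℕ} {A : Matrix (Fin d) (Fin d) ℝ}
    {B : Matrix (Fin d) (Fin e) ℝ} {C : Matrix (Fin e) (Fin d) ℝ} {P : Matrix (Fin d) (Fin d) ℝ}
    (hP : P.PosDef) (h : (ltiSystem A B C).IsStrictlyPassive fun τ => (1 / 2) * quadForm P τ) :
    (∀ τ : Vec d, τ ≠ 0 → τ.ofLp ⬝ᵥ (P *ᵥ (A *ᵥ τ.ofLp)) < 0) ∧
      ∀ (τ : Vec d) (v : Vec e), τ.ofLp ⬝ᵥ (P *ᵥ (B *ᵥ v.ofLp)) = v.ofLp ⬝ᵥ (C *ᵥ τ.ofLp) := by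
  have hinner : ∀ (M : Matrix (Fin d) (Fin d) ℝ) (u v : Vec d),
      ⟪u, (Matrix.toEuclideanLin M).toContinuousLinearMap v⟫_ℝ = u.ofLp ⬝ᵥ (M *ᵥ v.ofLp) := by
    intro M u v
    rw [EuclideanSpace.inner_eq_star_dotProduct, dotProduct_comm]
    rfl
  have hPt : Pᵀ = P := by
    have := hP.isHermitian.eq
    rwa [Matrix.conjTranspose_eq_transpose_of_trivial] at this
  have hsymm : ∀ u v : Vec d, ⟪u, (Matrix.toEuclideanLin P).toContinuousLinearMap v⟫_ℝ
      = ⟪v, (Matrix.toEuclideanLin P).toContinuousLinearMap u⟫_ℝ := by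
    intro u v
    rw [hinner, hinner, Matrix.dotProduct_mulVec, ← Matrix.mulVec_transpose, dotProduct_comm, hPt]
  have hfd : ∀ τ w : Vec d, fderiv ℝ (fun τ => (1 / 2) * quadForm P τ) τ w
      = τ.ofLp ⬝ᵥ (P *ᵥ w.ofLp) := by
    intro τ w
    have h1 := hasFDerivAt_half_inner _ hsymm τ
    have h2 : (fun τ : Vec d => (1 / 2) * quadForm P τ) = fun τ =>
        (1 / 2) * ⟪τ, (Matrix.toEuclideanLin P).toContinuousLinearMap τ⟫_ℝ := by
      funext τ
      rw [hinner]
      rfl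
    rw [h2, h1.fderiv, innerSL_apply_apply, real_inner_comm, hsymm, real_inner_comm, ← hinner]
    rw [real_inner_comm, hsymm]
  obtain ⟨-, -, -, -, φ, -, hφ, hineq⟩ := h
  have key : ∀ (τ : Vec d) (v : Vec e), τ.ofLp ⬝ᵥ (P *ᵥ (A *ᵥ τ.ofLp))
      + τ.ofLp ⬝ᵥ (P *ᵥ (B *ᵥ v.ofLp)) ≤ v.ofLp ⬝ᵥ (C *ᵥ τ.ofLp) - φ τ := by
    intro τ v
    have h1 := hineq τ (mem_univ _) v
    rw [hfd] at h1
    have h2 : ⟪v, (ltiSystem A B C).output τ v⟫_ℝ = v.ofLp ⬝ᵥ (C *ᵥ τ.ofLp) := by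
      rw [EuclideanSpace.inner_eq_star_dotProduct, dotProduct_comm]
      rfl
    rw [h2] at h1
    have h3 : ((ltiSystem A B C).field τ v).ofLp = A *ᵥ τ.ofLp + B *ᵥ v.ofLp := rfl
    rw [h3, Matrix.mulVec_add, dotProduct_add] at h1
    exact h1
  constructor
  · intro τ hτ
    have := key τ 0
    have := hφ τ hτ
    simp at *
    linarith
  · intro τ v
    by_contra hne
    set D := τ.ofLp ⬝ᵥ (P *ᵥ (B *ᵥ v.ofLp)) - v.ofLp ⬝ᵥ (C *ᵥ τ.ofLp) with hD
    have hD0 : D ≠ 0 := sub_ne_zero.2 hne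
    set b := - φ τ - τ.ofLp ⬝ᵥ (P *ᵥ (A *ᵥ τ.ofLp)) with hb
    -- Scaled this way, the linear part equals `b + 1`, whereas the inequality bounds it by `b`.
    have := key τ (((b + 1) / D) • v)
    simp only [WithLp.ofLp_smul, Matrix.mulVec_smul, dotProduct_smul, smul_dotProduct,
      smul_eq_mul] at this
    have h4 : (b + 1) / D * (τ.ofLp ⬝ᵥ (P *ᵥ (B *ᵥ v.ofLp)))
        - (b + 1) / D * (v.ofLp ⬝ᵥ (C *ᵥ τ.ofLp)) = b + 1 := by
      rw [← mul_sub, ← hD]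
      field_simp
    linarith

variable {ι : Type*} [Fintype ι] {d e : ι → ℕ}

/-- Compactness of the unit sphere turns strict negativity of the form into quadratic decay, which
replaces the unspecified `φ` of strict passivity from here on. -/
theorem blockMulCLM_passivity_conditions {A : ∀ i, Matrix (Fin (d i)) (Fin (d i)) ℝ}
    {B : ∀ i, Matrix (Fin (d i)) (Fin (e i)) ℝ} {C : ∀ i, Matrix (Fin (e i)) (Fin (d i)) ℝ}
    {P : ∀ i, Matrix (Fin (d i)) (Fin (d i)) ℝ} (hP : ∀ i, (P i).PosDef)
    (h : ∀ i, (ltiSystem (A i) (B i) (C i)).IsStrictlyPassive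
      fun τ => (1 / 2) * quadForm (P i) τ) :
    (∃ c > 0, ∀ τ, ⟪τ, blockMulCLM P (blockMulCLM A τ)⟫_ℝ ≤ -(c * ‖τ‖ ^ 2)) ∧
      ∀ τ v, ⟪τ, blockMulCLM P (blockMulCLM B v)⟫_ℝ = ⟪v, blockMulCLM C τ⟫_ℝ := by
  have hlti := fun i => ltiSystem_passivity_conditions (hP i) (h i)
  constructor
  · have hneg : ∀ i (v : Vec (d i)), v ≠ 0 → 0 < quadForm (-(P i * A i)) v := by
      intro i v hv
      have := (hlti i).1 v hv
      simp only [quadForm, Matrix.neg_mulVec, dotProduct_neg, ← Matrix.mulVec_mulVec]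
      linarith
    obtain ⟨c, hc, hle⟩ := exists_coercive_of_inner_pos _ (inner_blockMulCLM_pos hneg)
    refine ⟨c, hc, fun τ => ?_⟩
    have h1 := hle τ
    have h2 : ⟪τ, blockMulCLM (fun i => -(P i * A i)) τ⟫_ℝ
        = -⟪τ, blockMulCLM P (blockMulCLM A τ)⟫_ℝ := by
      rw [inner_blockMulCLM, inner_blockMulCLM, ← Finset.sum_neg_distrib]
      refine Finset.sum_congr rfl fun i _ => ?_
      rw [Matrix.neg_mulVec, dotProduct_neg, ← Matrix.mulVec_mulVec]
      rfl
    linarith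
  · intro τ v
    rw [inner_blockMulCLM, inner_blockMulCLM]
    exact Finset.sum_congr rfl fun i _ => (hlti i).2 (τ i) (v i)

theorem inner_blockMulCLM_comm {P : ∀ i, Matrix (Fin (d i)) (Fin (d i)) ℝ}
    (hP : ∀ i, (P i).PosDef) (u v : BlockVec d) :
    ⟪u, blockMulCLM P v⟫_ℝ = ⟪v, blockMulCLM P u⟫_ℝ := by
  rw [inner_blockMulCLM_transpose]
  congr 3
  funext i
  have := (hP i).isHermitian.eq
  rwa [Matrix.conjTranspose_eq_transpose_of_trivial] at this

theorem exists_coercive_blockMulCLM {P : ∀ i, Matrix (Fin (d i)) (Fin (d i)) ℝ}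
    (hP : ∀ i, (P i).PosDef) : ∃ c > 0, ∀ v, c * ‖v‖ ^ 2 ≤ ⟪v, blockMulCLM P v⟫_ℝ := by
  refine exists_coercive_of_inner_pos _ (inner_blockMulCLM_pos fun i v hv => ?_)
  have := (hP i).dotProduct_mulVec_pos (x := v.ofLp) (by
    intro h
    exact hv (by ext k; simp [h]))
  simpa [quadForm] using this

end LinearSystems

/-! ### Storage functions -/

section Storage

variable {ι : Type*} [Fintype ι] {n p q r : ι → ℕ} {m : ℕ}

theorem storageX_apply (Px : ∀ i, Matrix (Fin (p i)) (Fin (p i)) ℝ) (xs : BlockVec n)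
    (s : StateX n p) :
    storageX Px xs s = (1 / 2) * ‖s.1 - xs‖ ^ 2 + (1 / 2) * ⟪s.2, blockMulCLM Px s.2⟫_ℝ := by
  rw [← blockQuadForm_eq_inner]
  rfl

theorem storageLZ_apply (Pz : ∀ i, Matrix (Fin (q i)) (Fin (q i)) ℝ) (ls zs : AgentVec ι m)
    (s : StateLZ q r m) :
    storageLZ Pz ls zs s = (1 / 2) * ‖s.1 - ls‖ ^ 2 + (1 / 2) * ‖s.2.2.1 - zs‖ ^ 2
      + (1 / 2) * ‖s.2.1‖ ^ 2 + (1 / 2) * ⟪s.2.2.2, blockMulCLM Pz s.2.2.2⟫_ℝ := by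
  rw [← blockQuadForm_eq_inner]
  rfl

theorem hasFDerivAt_half_norm_sub_sq {E F : Type*} [NormedAddCommGroup E] [NormedSpace ℝ E]
    [NormedAddCommGroup F] [InnerProductSpace ℝ F] (L : E →L[ℝ] F) (c : F) (s : E) :
    HasFDerivAt (fun s => (1 / 2) * ‖L s - c‖ ^ 2) ((innerSL ℝ (L s - c)).comp L) s := by
  have := ((L.hasFDerivAt (x := s)).sub_const c).norm_sq.const_mul (1 / 2 : ℝ)
  refine this.congr_fderiv ?_
  ext v
  simp

theorem fderiv_storageX {Px : ∀ i, Matrix (Fin (p i)) (Fin (p i)) ℝ} (hP : ∀ i, (Px i).PosDef)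
    (xs : BlockVec n) (s w : StateX n p) :
    fderiv ℝ (storageX Px xs) s w = ⟪s.1 - xs, w.1⟫_ℝ + ⟪s.2, blockMulCLM Px w.2⟫_ℝ := by
  have h1 := hasFDerivAt_half_norm_sub_sq (.fst ℝ (BlockVec n) (BlockVec p)) xs s
  have h2 := (hasFDerivAt_half_inner _ (inner_blockMulCLM_comm hP) s.2).comp s
    (hasFDerivAt_snd (𝕜 := ℝ) (p := s))
  have h : HasFDerivAt (storageX Px xs) _ s := (h1.add h2).congr_of_eventuallyEq
    (Eventually.of_forall fun s => storageX_apply Px xs s)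
  rw [h.fderiv]
  have := inner_blockMulCLM_comm hP s.2 w.2
  have := real_inner_comm w.2 (blockMulCLM Px s.2)
  simp [inner_sub_left]
  linarith

theorem fderiv_storageLZ {Pz : ∀ i, Matrix (Fin (q i)) (Fin (q i)) ℝ} (hP : ∀ i, (Pz i).PosDef)
    (ls zs : AgentVec ι m) (s w : StateLZ q r m) :
    fderiv ℝ (storageLZ Pz ls zs) s w = ⟪s.1 - ls, w.1⟫_ℝ + ⟪s.2.2.1 - zs, w.2.2.1⟫_ℝ
      + ⟪s.2.1, w.2.1⟫_ℝ + ⟪s.2.2.2, blockMulCLM Pz w.2.2.2⟫_ℝ := by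
  have hsnd := hasFDerivAt_snd (𝕜 := ℝ) (p := s)
  have hsnd2 := (hasFDerivAt_snd (𝕜 := ℝ) (p := s.2)).comp s hsnd
  have hsnd3 := (hasFDerivAt_snd (𝕜 := ℝ) (p := s.2.2)).comp s hsnd2
  have h1 := hasFDerivAt_half_norm_sub_sq
    (.fst ℝ (AgentVec ι m) (BlockVec r × AgentVec ι m × BlockVec q)) ls s
  have h2 := hasFDerivAt_half_norm_sub_sq
    ((ContinuousLinearMap.fst ℝ (AgentVec ι m) (BlockVec q)).comp
      ((ContinuousLinearMap.snd ℝ (BlockVec r) (AgentVec ι m × BlockVec q)).comp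
        (.snd ℝ (AgentVec ι m) (BlockVec r × AgentVec ι m × BlockVec q)))) zs s
  have h3 := hasFDerivAt_half_norm_sub_sq
    ((ContinuousLinearMap.fst ℝ (BlockVec r) (AgentVec ι m × BlockVec q)).comp
        (.snd ℝ (AgentVec ι m) (BlockVec r × AgentVec ι m × BlockVec q))) 0 s
  have h4 := (hasFDerivAt_half_inner _ (inner_blockMulCLM_comm hP) s.2.2.2).comp s hsnd3
  have h : HasFDerivAt (storageLZ Pz ls zs) _ s :=
    (((h1.add h2).add h3).add h4).congr_of_eventuallyEq
    (Eventually.of_forall fun s => by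
      rw [storageLZ_apply]
      simp)
  rw [h.fderiv]
  have := inner_blockMulCLM_comm hP s.2.2.2 w.2.2.2
  have := real_inner_comm w.2.2.2 (blockMulCLM Pz s.2.2.2)
  simp [inner_sub_left]
  linarith

theorem contDiff_storageX (Px : ∀ i, Matrix (Fin (p i)) (Fin (p i)) ℝ) (xs : BlockVec n) :
    ContDiff ℝ 1 (storageX Px xs) := by
  rw [funext (storageX_apply Px xs)]
  refine (contDiff_const.mul ((contDiff_fst.sub contDiff_const).norm_sq ℝ)).add
    (contDiff_const.mul (contDiff_snd.inner ℝ ((blockMulCLM Px).contDiff.comp contDiff_snd)))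

theorem contDiff_storageLZ (Pz : ∀ i, Matrix (Fin (q i)) (Fin (q i)) ℝ) (ls zs : AgentVec ι m) :
    ContDiff ℝ 1 (storageLZ (r := r) Pz ls zs) := by
  rw [funext (storageLZ_apply Pz ls zs)]
  have h1 : ContDiff ℝ 1 fun s : StateLZ q r m => s.1 := contDiff_fst
  have h2 : ContDiff ℝ 1 fun s : StateLZ q r m => s.2.1 := contDiff_fst.comp contDiff_snd
  have h3 : ContDiff ℝ 1 fun s : StateLZ q r m => s.2.2.1 :=
    contDiff_fst.comp (contDiff_snd.comp contDiff_snd)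
  have h4 : ContDiff ℝ 1 fun s : StateLZ q r m => s.2.2.2 :=
    contDiff_snd.comp (contDiff_snd.comp contDiff_snd)
  exact (((contDiff_const.mul ((h1.sub contDiff_const).norm_sq ℝ)).add
    (contDiff_const.mul ((h3.sub contDiff_const).norm_sq ℝ))).add
    (contDiff_const.mul (h2.norm_sq ℝ))).add
    (contDiff_const.mul (h4.inner ℝ ((blockMulCLM Pz).contDiff.comp h4)))

theorem storageX_coercive {Px : ∀ i, Matrix (Fin (p i)) (Fin (p i)) ℝ}
    (hP : ∀ i, (Px i).PosDef) :
    ∃ c > 0, ∀ (xs : BlockVec n) (s : StateX n p),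
      c * ‖s - (xs, 0)‖ ^ 2 ≤ storageX Px xs s := by
  obtain ⟨c, hc, hle⟩ := exists_coercive_blockMulCLM hP
  -- The product carries the maximum norm, so it is enough to bound whichever component is larger.
  refine ⟨min 1 c / 2, by positivity, fun xs s => ?_⟩
  rw [storageX_apply, Prod.norm_def]
  simp only [Prod.fst_sub, Prod.snd_sub, sub_zero]
  have h1 := hle s.2
  have h2 : min 1 c * ‖s.2‖ ^ 2 ≤ c * ‖s.2‖ ^ 2 := by gcongr; exact min_le_right _ _
  have h3 : min 1 c * ‖s.1 - xs‖ ^ 2 ≤ 1 * ‖s.1 - xs‖ ^ 2 := by gcongr; exact min_le_left _ _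
  have h4 : 0 ≤ c * ‖s.2‖ ^ 2 := by positivity
  have h5 : 0 ≤ 1 * ‖s.1 - xs‖ ^ 2 := by positivity
  rcases max_choice ‖s.1 - xs‖ ‖s.2‖ with h | h <;> rw [h] <;> linarith

theorem storageLZ_coercive {Pz : ∀ i, Matrix (Fin (q i)) (Fin (q i)) ℝ}
    (hP : ∀ i, (Pz i).PosDef) :
    ∃ c > 0, ∀ (ls zs : AgentVec ι m) (s : StateLZ q r m),
      c * ‖s - (ls, 0, zs, 0)‖ ^ 2 ≤ storageLZ Pz ls zs s := by
  obtain ⟨c, hc, hle⟩ := exists_coercive_blockMulCLM hP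
  refine ⟨min 1 c / 2, by positivity, fun ls zs s => ?_⟩
  rw [storageLZ_apply, Prod.norm_def, Prod.norm_def, Prod.norm_def]
  simp only [Prod.fst_sub, Prod.snd_sub, sub_zero]
  have h1 := hle s.2.2.2
  have h2 : min 1 c * ‖s.2.2.2‖ ^ 2 ≤ c * ‖s.2.2.2‖ ^ 2 := by gcongr; exact min_le_right _ _
  have hone : ∀ t : ℝ, min 1 c * t ^ 2 ≤ 1 * t ^ 2 := fun t => by
    gcongr; exact min_le_left _ _
  have h3 := hone ‖s.1 - ls‖
  have h4 := hone ‖s.2.1‖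
  have h5 := hone ‖s.2.2.1 - zs‖
  have h6 : 0 ≤ c * ‖s.2.2.2‖ ^ 2 := by positivity
  have h7 := sq_nonneg ‖s.1 - ls‖
  have h8 := sq_nonneg ‖s.2.1‖
  have h9 := sq_nonneg ‖s.2.2.1 - zs‖
  rcases max_choice ‖s.1 - ls‖ (max ‖s.2.1‖ (max ‖s.2.2.1 - zs‖ ‖s.2.2.2‖)) with h | h
  · rw [h]; linarith
  rw [h]
  rcases max_choice ‖s.2.1‖ (max ‖s.2.2.1 - zs‖ ‖s.2.2.2‖) with h | h
  · rw [h]; linarith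
  rw [h]
  rcases max_choice ‖s.2.2.1 - zs‖ ‖s.2.2.2‖ with h | h <;> rw [h] <;> linarith

end Storage

/-! ### Convex games -/

section Games

variable {ι : Type*} {n : ι → ℕ} {m : ℕ}

theorem inner_vec (u v : Vec m) : ⟪u, v⟫_ℝ = ∑ k, u k * v k := by
  simp [PiLp.inner_apply, mul_comm]

theorem Game.hasFDerivAt_g_apply {𝒢 : Game ι n m} (hg : ∀ i, Differentiable ℝ (𝒢.g i)) (i : ι)
    (x : Vec (n i)) (k : Fin m) :
    HasFDerivAt (fun y => 𝒢.g i y k)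
      ((EuclideanSpace.proj k : Vec m →L[ℝ] ℝ).comp (fderiv ℝ (𝒢.g i) x)) x :=
  (EuclideanSpace.proj k : Vec m →L[ℝ] ℝ).hasFDerivAt.comp x (hg i x).hasFDerivAt

variable [Fintype ι] [DecidableEq ι]

theorem Game.IsConvex.g_gradient_inequality {𝒢 : Game ι n m} (h𝒢 : 𝒢.IsConvex) (i : ι)
    (x y : Vec (n i)) {mu : Vec m} (hmu : mu ∈ orthant m) :
    ⟪ContinuousLinearMap.adjoint (fderiv ℝ (𝒢.g i) x) mu, y - x⟫_ℝ ≤ ⟪mu, 𝒢.g i y - 𝒢.g i x⟫_ℝ := by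
  rw [ContinuousLinearMap.adjoint_inner_left, inner_vec, inner_vec]
  refine Finset.sum_le_sum fun k _ => ?_
  have := convexOn_gradient_inequality ((h𝒢.2.1 i).2 k)
    (Game.hasFDerivAt_g_apply (fun i => (h𝒢.2.1 i).1) i x k) y
  have h1 : (fderiv ℝ (𝒢.g i) x (y - x)) k ≤ 𝒢.g i y k - 𝒢.g i x k := by
    have h2 : 𝒢.g i x k + (fderiv ℝ (𝒢.g i) x (y - x)) k ≤ 𝒢.g i y k := this
    linarith
  exact mul_le_mul_of_nonneg_left h1 (hmu k)

theorem Game.IsConvex.inner_gradGT_le {𝒢 : Game ι n m} (h𝒢 : 𝒢.IsConvex) (x y : BlockVec n)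
    {l : AgentVec ι m} (hl : l ∈ blockOrthant fun _ => m) :
    ⟪𝒢.gradGT x l, y - x⟫_ℝ ≤ ⟪l, 𝒢.G y - 𝒢.G x⟫_ℝ := by
  rw [PiLp.inner_apply, PiLp.inner_apply]
  exact Finset.sum_le_sum fun i _ => h𝒢.g_gradient_inequality i (x i) (y i) (hl i)

theorem Game.IsConvex.J_gradient_inequality {𝒢 : Game ι n m} (h𝒢 : 𝒢.IsConvex) (i : ι)
    (x : BlockVec n) (y : Vec (n i)) :
    𝒢.J i x + ⟪𝒢.partialGrad i x, y - x i⟫_ℝ ≤ 𝒢.J i (replace x i y) := by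
  have hd : DifferentiableAt ℝ (fun y : Vec (n i) => 𝒢.J i (replace x i y)) (x i) :=
    (h𝒢.1 i x).1.differentiable one_ne_zero _
  have := convexOn_gradient_inequality (h𝒢.1 i x).2 hd.hasGradientAt.hasFDerivAt y
  have hrep : replace x i (x i) = x := by
    ext j
    simp [replace]
  rw [hrep] at this
  simpa [Game.partialGrad] using this

/-- Nothing is assumed about how `J i` depends on the other players. But a standard basis vector
moves one player's block only, and the matching component of `F` is a partial derivative of that
player's own cost, continuous along this direction. Monotonicity does the rest. -/
theorem Game.IsConvex.continuous_F {𝒢 : Game ι n m} (h𝒢 : 𝒢.IsConvex) (hF : 𝒢.IsMonotone) :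
    Continuous 𝒢.F := by
  refine continuous_of_monotone_of_directional
    (Pi.orthonormalBasis fun i => EuclideanSpace.basisFun (Fin (n i)) ℝ) hF ?_
  rintro x ⟨i, k⟩
  have hcomp : (fun t : ℝ => ⟪(Pi.orthonormalBasis
        fun i => EuclideanSpace.basisFun (Fin (n i)) ℝ) ⟨i, k⟩,
        𝒢.F (x + t • (Pi.orthonormalBasis
          fun i => EuclideanSpace.basisFun (Fin (n i)) ℝ) ⟨i, k⟩)⟫_ℝ)
      = fun t : ℝ => ⟪EuclideanSpace.basisFun (Fin (n i)) ℝ k,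
        gradient (fun y : Vec (n i) => 𝒢.J i (replace x i y))
          (x i + t • EuclideanSpace.basisFun (Fin (n i)) ℝ k)⟫_ℝ := by
    funext t
    rw [Pi.orthonormalBasis_apply, PiLp.inner_apply, Finset.sum_eq_single i]
    · have hrep : ∀ y, replace (x + t • PiLp.single 2 i
          (EuclideanSpace.basisFun (Fin (n i)) ℝ k)) i y = replace x i y := by
        intro y
        ext j
        by_cases hj : j = i
        · subst hj; simp [replace]
        · simp [replace, hj]
      simp only [Game.F, Game.partialGrad, hrep]
      simp
    · intro j _ hj
      simp [hj]
    · simp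
  rw [hcomp]
  have hgrad : Continuous fun y => gradient (fun y : Vec (n i) => 𝒢.J i (replace x i y)) y := by
    unfold gradient
    exact (InnerProductSpace.toDual ℝ _).symm.continuous.comp
      ((h𝒢.1 i x).1.continuous_fderiv one_ne_zero)
  refine Continuous.continuousAt ?_
  exact continuous_const.inner (hgrad.comp (by fun_prop))

theorem Game.IsConvex.continuous_G {𝒢 : Game ι n m} (h𝒢 : 𝒢.IsConvex) : Continuous 𝒢.G := by
  unfold Game.G
  refine (PiLp.continuous_toLp 2 _).comp (continuous_pi fun i => ?_)
  exact (h𝒢.2.1 i).1.continuous.comp (by fun_prop)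

theorem Game.IsConvex.continuous_gradGT {𝒢 : Game ι n m} (h𝒢 : 𝒢.IsConvex) :
    Continuous fun p : BlockVec n × AgentVec ι m => 𝒢.gradGT p.1 p.2 := by
  unfold Game.gradGT
  refine (PiLp.continuous_toLp 2 _).comp (continuous_pi fun i => ?_)
  have hfd : Continuous fun y => fderiv ℝ (𝒢.g i) y := by
    rw [continuous_clm_apply]
    intro v
    have hk : ∀ k, Continuous fun y => (fderiv ℝ (𝒢.g i) y v) k := by
      intro k
      have := continuous_fderiv_apply_of_convexOn ((h𝒢.2.1 i).2 k) (fun y =>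
        (Game.hasFDerivAt_g_apply (fun i => (h𝒢.2.1 i).1) i y k).differentiableAt) v
      refine this.congr fun y => ?_
      rw [(Game.hasFDerivAt_g_apply (fun i => (h𝒢.2.1 i).1) i y k).fderiv]
      rfl
    exact (PiLp.continuous_toLp 2 _).comp (continuous_pi hk)
  have hadj : Continuous fun y => ContinuousLinearMap.adjoint (fderiv ℝ (𝒢.g i) y) :=
    ContinuousLinearMap.adjoint.continuous.comp hfd
  have h1 : Continuous fun p : BlockVec n × AgentVec ι m => p.1 i := by fun_prop
  have h2 : Continuous fun p : BlockVec n × AgentVec ι m => p.2 i := by fun_prop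
  exact (hadj.comp h1).clm_apply h2

end Games

/-! ### Equilibria -/

section Equilibria

variable {ι : Type*} [Fintype ι] {n p q r : ι → ℕ} {m : ℕ}

theorem Compensators.xOut_eq (K : Compensators ι n p q r m) (s : StateX n p) :
    K.xOut s = s.1 + blockMulCLM K.Ψx s.2 := rfl

theorem Compensators.zOut_eq (K : Compensators ι n p q r m) (s : StateLZ q r m) :
    K.zOut s = s.2.2.1 + blockMulCLM K.Ψz s.2.2.2 := rfl

theorem Compensators.lamOut_eq (K : Compensators ι n p q r m) (s : StateLZ q r m) :
    K.lamOut s = s.1 + blockPos (blockMulCLM K.Ψl s.2.1) := rfl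

theorem Compensators.inner_Θl (K : Compensators ι n p q r m) (τ : BlockVec r) (v : AgentVec ι m) :
    ⟪τ, blockMulCLM K.Θl v⟫_ℝ = ⟪v, blockMulCLM K.Ψl τ⟫_ℝ :=
  inner_blockMulCLM_transpose _ _ _

variable {K : Compensators ι n p q r m} {Px : ∀ i, Matrix (Fin (p i)) (Fin (p i)) ℝ}
  {Pz : ∀ i, Matrix (Fin (q i)) (Fin (q i)) ℝ}

theorem Compensators.IsAdmissible.exists_Φl (hK : K.IsAdmissible Px Pz) :
    ∃ c > 0, ∀ τ, ⟪τ, blockMulCLM K.Φl τ⟫_ℝ ≤ -(c * ‖τ‖ ^ 2) := by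
  obtain ⟨c, hc, h⟩ := exists_coercive_of_inner_pos (-blockMulCLM K.Φl) (fun v hv => by
    have hneg : ∀ i (v : Vec (r i)), v ≠ 0 → 0 < quadForm (-(K.Φl i)) v := by
      intro i v hv
      have := (hK.2.2 i).1 v hv
      simp only [quadForm, Matrix.neg_mulVec, dotProduct_neg] at this ⊢
      linarith
    have := inner_blockMulCLM_pos hneg v hv
    rw [inner_blockMulCLM] at this
    rw [neg_apply, inner_neg_right, inner_blockMulCLM,
      ← Finset.sum_neg_distrib]
    simpa [Matrix.neg_mulVec] using this)
  refine ⟨c, hc, fun τ => ?_⟩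
  have := h τ
  rw [neg_apply, inner_neg_right] at this
  linarith

theorem Compensators.IsAdmissible.Ψl_mem (hK : K.IsAdmissible Px Pz) {τ : BlockVec r}
    (hτ : τ ∈ blockOrthant r) : blockMulCLM K.Ψl τ ∈ blockOrthant fun _ => m := by
  intro i k
  rw [blockMulCLM_apply_apply]
  exact Finset.sum_nonneg fun l _ => mul_nonneg ((hK.2.2 i).2.1 l k) (hτ i l)

/-- Entrywise nonnegativity of `Θl` makes the maximum in the output inactive on the domain, so there
`λ` is linear in the state. -/
theorem Compensators.IsAdmissible.lamOut_of_mem (hK : K.IsAdmissible Px Pz) {s : StateLZ q r m}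
    (hs : s ∈ stateSetLZ q r m) : K.lamOut s = s.1 + blockMulCLM K.Ψl s.2.1 := by
  rw [K.lamOut_eq, blockPos_of_mem_blockOrthant (hK.Ψl_mem hs.2)]

theorem Compensators.IsAdmissible.lamOut_mem (hK : K.IsAdmissible Px Pz) {s : StateLZ q r m}
    (hs : s ∈ stateSetLZ q r m) : K.lamOut s ∈ blockOrthant fun _ => m := by
  intro i k
  rw [hK.lamOut_of_mem hs]
  exact add_nonneg (hs.1 i k) (hK.Ψl_mem hs.2 i k)

theorem inner_nonpos_of_nonneg_of_nonpos {d : ι → ℕ} {v w : BlockVec d} (hv : v ∈ blockOrthant d)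
    (hw : ∀ i k, w i k ≤ 0) : ⟪v, w⟫_ℝ ≤ 0 := by
  rw [blockVec_inner]
  exact Finset.sum_nonpos fun i _ => Finset.sum_nonpos fun k _ =>
    mul_nonpos_of_nonneg_of_nonpos (hv i k) (hw i k)

theorem blockMulCLM_state_eq_zero {d : ι → ℕ} {A : ∀ i, Matrix (Fin (d i)) (Fin (d i)) ℝ}
    {P : ∀ i, Matrix (Fin (d i)) (Fin (d i)) ℝ}
    (h : ∃ c > 0, ∀ τ, ⟪τ, blockMulCLM P (blockMulCLM A τ)⟫_ℝ ≤ -(c * ‖τ‖ ^ 2))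
    {τ : BlockVec d} (hτ : blockMulCLM A τ = 0) : τ = 0 := by
  obtain ⟨c, hc, h⟩ := h
  have := h τ
  rw [hτ, map_zero, inner_zero_right] at this
  have : ‖τ‖ ^ 2 = 0 := by nlinarith [sq_nonneg ‖τ‖]
  exact norm_eq_zero.1 (pow_eq_zero_iff two_ne_zero |>.1 this)

variable [DecidableEq ι]

/-- The conditions on the outputs `(x, λ, z)` at an equilibrium. -/
structure IsRestPoint (𝒢 : Game ι n m) (a : Matrix ι ι ℝ) (x : BlockVec n) (l z : AgentVec ι m) :
    Prop where
  nonneg : l ∈ blockOrthant fun _ => m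
  stationary : 𝒢.F x + 𝒢.gradGT x l = 0
  consensus : lapMul a l = 0
  complementary : ∀ i k, (𝒢.G x - lapMul a z) i k ≤ 0 ∧
    (l i k ≠ 0 → (𝒢.G x - lapMul a z) i k = 0)

theorem IsRestPoint.inner_eq_zero {𝒢 : Game ι n m} {a : Matrix ι ι ℝ} {x : BlockVec n}
    {l z : AgentVec ι m} (h : IsRestPoint 𝒢 a x l z) : ⟪l, 𝒢.G x - lapMul a z⟫_ℝ = 0 := by
  rw [blockVec_inner]
  refine Finset.sum_eq_zero fun i _ => Finset.sum_eq_zero fun k _ => ?_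
  by_cases hl : l i k = 0
  · rw [hl, zero_mul]
  · rw [(h.complementary i k).2 hl, mul_zero]

/-- For `τ_x` and `τ_z` the input vanishes and the state matrix is injective by strict passivity.
For `τ_λ`, pairing its equation with `τ_λ` removes the projection and leaves `0 = τᵀ Φ τ + (Ψ τ)ᵀ
v_λ`. Both terms are nonpositive, since `ρ_λ` at rest forces `v_λ ≤ 0`; definiteness of `Φ` then
gives `τ_λ = 0`. -/
theorem isEquilibrium_iff {𝒢 : Game ι n m} {a : Matrix ι ι ℝ} (hK : K.IsAdmissible Px Pz)
    (s : FullState n p q r m) :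
    IsEquilibrium 𝒢 a K s ↔ s.1.2 = 0 ∧ s.2.2.1 = 0 ∧ s.2.2.2.2 = 0 ∧
      IsRestPoint 𝒢 a s.1.1 s.2.1 s.2.2.2.1 := by
  obtain ⟨⟨ρx, τx⟩, ρl, τl, ρz, τz⟩ := s
  constructor
  · rintro ⟨hs, hdyn⟩
    simp only [dynField, Compensators.fieldX, Compensators.fieldLZ, Prod.mk_eq_zero] at hdyn
    obtain ⟨⟨hx, hτx⟩, hl, hτl, hz, hτz⟩ := hdyn
    rw [hx, ← blockMulCLM_apply, ← blockMulCLM_apply, map_zero, add_zero] at hτx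
    rw [hz, ← blockMulCLM_apply, ← blockMulCLM_apply, map_zero, add_zero] at hτz
    have hx0 : τx = 0 := blockMulCLM_state_eq_zero
      (blockMulCLM_passivity_conditions (fun i => (hK.1 i).1) fun i => (hK.1 i).2.2).1 hτx
    have hz0 : τz = 0 := blockMulCLM_state_eq_zero
      (blockMulCLM_passivity_conditions (fun i => (hK.2.1 i).1) fun i => (hK.2.1 i).2.2).1 hτz
    have hl0 : τl = 0 := by
      obtain ⟨c, hc, hΦ⟩ := hK.exists_Φl
      have h1 := hΦ τl
      rw [projOp_eq_zero_iff hs.1] at hl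
      have h2 := inner_projOp hs.2 (blockMul K.Φl τl + blockMul K.Θl
        (𝒢.G (K.xOut (ρx, τx)) - lapMul a (K.zOut (ρl, τl, ρz, τz))
          - lapMul a (K.lamOut (ρl, τl, ρz, τz))))
      simp only at h2
      rw [hτl, inner_zero_right, inner_add_right, ← blockMulCLM_apply, ← blockMulCLM_apply,
        K.inner_Θl, real_inner_comm] at h2
      have h3 := inner_nonpos_of_nonneg_of_nonpos (hK.Ψl_mem hs.2) fun i k => (hl i k).1
      rw [real_inner_comm] at h2
      simp only at h3
      rw [real_inner_comm] at h3
      have : ‖τl‖ ^ 2 = 0 := by nlinarith [sq_nonneg ‖τl‖]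
      exact norm_eq_zero.1 (pow_eq_zero_iff two_ne_zero |>.1 this)
    subst hx0 hz0 hl0
    have e1 : K.xOut (ρx, 0) = ρx := by simp [K.xOut_eq]
    have e2 : K.lamOut (ρl, 0, ρz, 0) = ρl := by rw [hK.lamOut_of_mem hs]; simp
    have e3 : K.zOut (ρl, 0, ρz, 0) = ρz := by simp [K.zOut_eq]
    rw [e1, e2] at hx
    rw [e2] at hz
    rw [e1, e2, e3, hz, sub_zero, projOp_eq_zero_iff hs.1] at hl
    refine ⟨rfl, rfl, rfl, hs.1, ?_, hz, hl⟩
    rw [← neg_eq_zero, neg_add, ← sub_eq_add_neg]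
    exact hx
  · rintro ⟨h1, h2, h3, h⟩
    simp only at h1 h2 h3 h
    subst h1 h2 h3
    have hs : ((ρl, 0, ρz, 0) : StateLZ q r m) ∈ stateSetLZ q r m :=
      ⟨h.nonneg, fun _ _ => le_rfl⟩
    refine ⟨hs, ?_⟩
    have e1 : K.xOut (ρx, 0) = ρx := by simp [K.xOut_eq]
    have e2 : K.lamOut (ρl, 0, ρz, 0) = ρl := by rw [hK.lamOut_of_mem hs]; simp
    have e3 : K.zOut (ρl, 0, ρz, 0) = ρz := by simp [K.zOut_eq]
    have hx : - 𝒢.F ρx - 𝒢.gradGT ρx ρl = 0 := by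
      rw [sub_eq_add_neg, ← neg_add, h.stationary, neg_zero]
    simp only [dynField, Compensators.fieldX, Compensators.fieldLZ, Prod.mk_eq_zero, e1, e2, e3,
      hx, h.consensus, ← blockMulCLM_apply, map_zero, add_zero, zero_add, sub_zero, and_true,
      true_and]
    rw [projOp_eq_zero_iff hs.1, projOp_eq_zero_iff hs.2]
    -- Since `Θl ≥ 0` and `v_λ ≤ 0`, the compensator is pushed into the boundary at `τ_λ = 0` and
    -- the projection holds it there.
    refine ⟨h.complementary, fun i k => ⟨?_, fun hne => absurd rfl hne⟩⟩
    rw [blockMulCLM_apply_apply]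
    exact Finset.sum_nonpos fun l _ =>
      mul_nonpos_of_nonneg_of_nonpos ((hK.2.2 i).2.1 k l) (h.complementary i l).1

/-- Every agent takes the common multiplier, and `z` is chosen so that `L z` spreads the total
constraint value equally: each agent sees `g(x)` divided by the number of agents, which inherits its
sign and complementarity. The required `L z` has zero block sum, so such a `z` exists. -/
theorem Game.IsVariationalGNE.exists_restPoint {𝒢 : Game ι n m} {a : Matrix ι ι ℝ}
    {Gc : SimpleGraph ι} (ha : IsWeightedAdjacency Gc a) (hGc : Gc.Connected) {x : BlockVec n}
    (hx : 𝒢.IsVariationalGNE x) : ∃ l z, IsRestPoint 𝒢 a x l z := by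
  obtain ⟨⟨hfeas, -⟩, mu, hmu, hstat, hnc⟩ := hx
  have := hGc.nonempty
  have hcard : (Fintype.card ι : ℝ) ≠ 0 := Nat.cast_ne_zero.2 Fintype.card_ne_zero
  set w : AgentVec ι m := WithLp.toLp 2 fun _ => (Fintype.card ι : ℝ)⁻¹ • 𝒢.gSum x with hw
  obtain ⟨z, hz⟩ := exists_lapMul_eq ha hGc (v := 𝒢.G x - w) (by
    simp only [PiLp.sub_apply, Finset.sum_sub_distrib, hw, Finset.sum_const, Finset.card_univ]
    rw [← Nat.cast_smul_eq_nsmul ℝ, smul_smul, mul_inv_cancel₀ hcard, one_smul]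
    exact sub_self _)
  refine ⟨WithLp.toLp 2 fun _ => mu, z, fun i => hmu, ?_, lapMul_const a fun _ _ => rfl, ?_⟩
  · ext i : 1
    exact hstat i
  · rw [hz, sub_sub_cancel]
    have hcomp : ∀ k, mu k ≠ 0 → 𝒢.gSum x k = 0 := by
      have h0 : ⟪𝒢.gSum x, mu⟫_ℝ ≤ 0 := by
        rw [inner_vec]
        exact Finset.sum_nonpos fun k _ => mul_nonpos_of_nonpos_of_nonneg (hfeas k) (hmu k)
      have h1 : 0 ≤ ⟪𝒢.gSum x, mu⟫_ℝ := by
        -- The origin as test point in the normal cone condition gives the sign opposite to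
        -- feasibility.
        have := hnc 0 fun k => le_rfl
        rw [zero_sub, inner_neg_right] at this
        linarith
      have h2 := le_antisymm h0 h1
      rw [inner_vec, Finset.sum_eq_zero_iff_of_nonpos fun k _ =>
        mul_nonpos_of_nonpos_of_nonneg (hfeas k) (hmu k)] at h2
      exact fun k hk => (mul_eq_zero.1 (h2 k (Finset.mem_univ k))).resolve_right hk
    intro i k
    have happ : w i k = (Fintype.card ι : ℝ)⁻¹ * 𝒢.gSum x k := rfl
    rw [happ]
    exact ⟨mul_nonpos_of_nonneg_of_nonpos (by positivity) (hfeas k),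
      fun hk => by rw [hcomp k hk, mul_zero]⟩

/-- Consensus yields a single multiplier. Summing the local conditions over the agents cancels `L z`
and leaves feasibility and complementarity for `g`. KKT is then sufficient for optimality by the
gradient inequalities for `J i` and `g i`. -/
theorem IsRestPoint.isVariationalGNE {𝒢 : Game ι n m} {a : Matrix ι ι ℝ} {Gc : SimpleGraph ι}
    (h𝒢 : 𝒢.IsConvex) (ha : IsWeightedAdjacency Gc a) (hGc : Gc.Connected) {x : BlockVec n}
    {l z : AgentVec ι m} (h : IsRestPoint 𝒢 a x l z) : 𝒢.IsVariationalGNE x := by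
  obtain ⟨i₀⟩ := hGc.nonempty
  set mu : Vec m := l i₀ with hmu
  have hl : ∀ i, l i = mu := fun i => eq_of_lapMul_eq_zero ha hGc h.consensus i i₀
  have hmu0 : mu ∈ orthant m := fun k => h.nonneg i₀ k
  have hstat : ∀ i, 𝒢.partialGrad i x
      + ContinuousLinearMap.adjoint (fderiv ℝ (𝒢.g i) (x i)) mu = 0 := by
    intro i
    have := congrArg (fun v : BlockVec n => v i) h.stationary
    rw [← hl i]
    exact this
  have hsum : ∀ k, 𝒢.gSum x k = ∑ i, (𝒢.G x - lapMul a z) i k := by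
    intro k
    have h1 : 𝒢.gSum x = ∑ i, (𝒢.G x - lapMul a z) i := by
      simp only [PiLp.sub_apply, Finset.sum_sub_distrib]
      rw [sum_lapMul ha.1, sub_zero]
      rfl
    rw [h1]
    simp
  have hfeas : x ∈ 𝒢.feasible := fun k => by
    rw [hsum]
    exact Finset.sum_nonpos fun i _ => (h.complementary i k).1
  have hcomp : ∀ k, mu k ≠ 0 → 𝒢.gSum x k = 0 := fun k hk => by
    rw [hsum]
    exact Finset.sum_eq_zero fun i _ => (h.complementary i k).2 (by rwa [hl])
  have horth : ⟪mu, 𝒢.gSum x⟫_ℝ = 0 := by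
    rw [inner_vec]
    refine Finset.sum_eq_zero fun k _ => ?_
    by_cases hk : mu k = 0
    · rw [hk, zero_mul]
    · rw [hcomp k hk, mul_zero]
  refine ⟨⟨hfeas, fun i y hy => ?_⟩, mu, hmu0, hstat, fun y hy => ?_⟩
  · have h1 := h𝒢.J_gradient_inequality i x y
    have h2 := h𝒢.g_gradient_inequality i (x i) y hmu0
    have h3 : ⟪𝒢.partialGrad i x, y - x i⟫_ℝ
        = -⟪ContinuousLinearMap.adjoint (fderiv ℝ (𝒢.g i) (x i)) mu, y - x i⟫_ℝ := by
      rw [eq_neg_of_add_eq_zero_left (hstat i), inner_neg_left]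
    have h4 : 𝒢.gSum (replace x i y) - 𝒢.gSum x = 𝒢.g i y - 𝒢.g i (x i) := by
      unfold Game.gSum
      rw [← Finset.sum_sub_distrib, Finset.sum_eq_single i]
      · simp [replace]
      · intro j _ hj
        simp [replace, hj]
      · simp
    have h5 : ⟪mu, 𝒢.gSum (replace x i y)⟫_ℝ ≤ 0 := by
      rw [inner_vec]
      exact Finset.sum_nonpos fun k _ => mul_nonpos_of_nonneg_of_nonpos (hmu0 k) (hy k)
    rw [← h4, inner_sub_right mu, horth] at h2
    linarith
  · rw [inner_sub_right, real_inner_comm, real_inner_comm mu, horth, sub_zero, inner_vec]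
    exact Finset.sum_nonpos fun k _ => mul_nonpos_of_nonneg_of_nonpos (hy k) (hfeas k)

end Equilibria

/-! ### Dissipation inequalities -/

section Dissipation

variable {ι : Type*} [Fintype ι] [DecidableEq ι] {n p q r : ι → ℕ} {m : ℕ}
  {K : Compensators ι n p q r m} {Px : ∀ i, Matrix (Fin (p i)) (Fin (p i)) ℝ}
  {Pz : ∀ i, Matrix (Fin (q i)) (Fin (q i)) ℝ} {𝒢 : Game ι n m} {a : Matrix ι ι ℝ}

/-- By `P Θ = Ψᵀ` the contributions of `ρ` and `τ` add up to the pairing of `v` with the full output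
error `x - x*`, where monotonicity of `F` applies. What remains of the compensator is its quadratic
loss. -/
theorem sigmaX_dissipation (hK : K.IsAdmissible Px Pz) (hF : 𝒢.IsMonotone) :
    ∃ c > 0, ∀ (xs : BlockVec n) (s : StateX n p) (u : BlockVec n),
      fderiv ℝ (storageX Px xs) s ((sigmaX 𝒢 K).field s u)
        ≤ ⟪u - 𝒢.F xs, K.xOut s - xs⟫_ℝ - c * ‖s.2‖ ^ 2 := by
  obtain ⟨⟨c, hc, hA⟩, hB⟩ :=
    blockMulCLM_passivity_conditions (fun i => (hK.1 i).1) fun i => (hK.1 i).2.2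
  refine ⟨c, hc, fun xs s u => ?_⟩
  rw [fderiv_storageX fun i => (hK.1 i).1]
  set v := - 𝒢.F (K.xOut s) + u with hv
  have hfield : (sigmaX 𝒢 K).field s u
      = (v, blockMulCLM K.Φx s.2 + blockMulCLM K.Θx v) := rfl
  rw [hfield]
  simp only [map_add, inner_add_right, hB]
  have h1 := hA s.2
  have h2 := hF (K.xOut s) xs
  have h3 : ⟪s.1 - xs, v⟫_ℝ + ⟪v, blockMulCLM K.Ψx s.2⟫_ℝ = ⟪K.xOut s - xs, v⟫_ℝ := by
    rw [real_inner_comm, ← inner_add_right, real_inner_comm, K.xOut_eq]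
    congr 1
    abel
  have h4 : ⟪K.xOut s - xs, v⟫_ℝ = ⟪u - 𝒢.F xs, K.xOut s - xs⟫_ℝ
      - ⟪K.xOut s - xs, 𝒢.F (K.xOut s) - 𝒢.F xs⟫_ℝ := by
    rw [real_inner_comm (K.xOut s - xs) (u - 𝒢.F xs), ← inner_sub_right, hv]
    congr 1
    abel
  linarith

/-- The signals again pair with the output errors, the projections costing nothing: they can only
lower the `ρ_λ` term and leave the `τ_λ` term unchanged. -/
theorem sigmaLZ_dissipation {Gc : SimpleGraph ι} (h𝒢 : 𝒢.IsConvex)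
    (ha : IsWeightedAdjacency Gc a) (hK : K.IsAdmissible Px Pz) :
    ∃ c > 0, ∀ (xs : BlockVec n) (ls zs : AgentVec ι m), IsRestPoint 𝒢 a xs ls zs →
      ∀ s ∈ stateSetLZ q r m, ∀ u : BlockVec n,
      fderiv ℝ (storageLZ Pz ls zs) s ((sigmaLZ 𝒢 a K).field s u)
        ≤ ⟪u - xs, 𝒢.gradGT u (K.lamOut s) - 𝒢.gradGT xs ls⟫_ℝ
          - c * (‖s.2.1‖ ^ 2 + ‖s.2.2.2‖ ^ 2) := by
  obtain ⟨⟨c, hc, hA⟩, hB⟩ :=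
    blockMulCLM_passivity_conditions (fun i => (hK.2.1 i).1) fun i => (hK.2.1 i).2.2
  obtain ⟨c', hc', hΦ⟩ := hK.exists_Φl
  refine ⟨min c c', by positivity, fun xs ls zs hrest s hs u => ?_⟩
  rw [fderiv_storageLZ fun i => (hK.2.1 i).1]
  set l := K.lamOut s with hl
  set z := K.zOut s with hz
  set v := 𝒢.G u - lapMul a z - lapMul a l with hv
  have hfield : (sigmaLZ 𝒢 a K).field s u
      = (projOp (blockOrthant fun _ => m) s.1 v,
        projOp (blockOrthant r) s.2.1 (blockMulCLM K.Φl s.2.1 + blockMulCLM K.Θl v),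
        lapMul a l, blockMulCLM K.Φz s.2.2.2 + blockMulCLM K.Θz (lapMul a l)) := rfl
  rw [hfield]
  simp only [map_add, inner_add_right, hB, inner_projOp hs.2, K.inner_Θl]
  have h1 := inner_sub_projOp_le hs.1 hrest.nonneg v
  have h2 := hA s.2.2.2
  have h3 := hΦ s.2.1
  have h4 : ⟪s.1 - ls, v⟫_ℝ + ⟪v, blockMulCLM K.Ψl s.2.1⟫_ℝ = ⟪l - ls, v⟫_ℝ := by
    rw [real_inner_comm, ← inner_add_right, real_inner_comm, hl, hK.lamOut_of_mem hs]
    congr 1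
    abel
  have h5 : ⟪s.2.2.1 - zs, lapMul a l⟫_ℝ + ⟪lapMul a l, blockMulCLM K.Ψz s.2.2.2⟫_ℝ
      = ⟪z - zs, lapMul a l⟫_ℝ := by
    rw [real_inner_comm, ← inner_add_right, real_inner_comm, hz, K.zOut_eq]
    congr 1
    abel
  have hlmem : l ∈ blockOrthant fun _ => m := hK.lamOut_mem hs
  have hsymm := fun v w : AgentVec ι m => inner_lapMul_comm ha.1 v w
  -- Symmetry of the Laplacian and `L λ* = 0` cancel the exchange between `λ` and `z`. Apart from
  -- the supply term, the rest is nonpositive by complementarity at the rest point and positive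
  -- semidefiniteness.
  have h6 : ⟪l - ls, v⟫_ℝ + ⟪z - zs, lapMul a l⟫_ℝ
      = ⟪l - ls, 𝒢.G u - 𝒢.G xs⟫_ℝ + ⟪l, 𝒢.G xs - lapMul a zs⟫_ℝ
        - ⟪ls, 𝒢.G xs - lapMul a zs⟫_ℝ - ⟪l, lapMul a l⟫_ℝ := by
    have e1 := hsymm z l
    have e2 := hsymm zs l
    have e3 := hsymm ls z
    have e4 := hsymm ls l
    have e5 := hsymm ls zs
    rw [hrest.consensus, inner_zero_right] at e3 e4 e5
    simp only [hv, inner_sub_left, inner_sub_right]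
    linarith
  have h7 := hrest.inner_eq_zero
  have h8 := inner_nonpos_of_nonneg_of_nonpos hlmem fun i k => (hrest.complementary i k).1
  have h9 := inner_lapMul_self_nonneg ha l
  have h10 := h𝒢.inner_gradGT_le u xs hlmem
  have h11 := h𝒢.inner_gradGT_le xs u hrest.nonneg
  -- Convexity is used at both points: linearize at `u` with weight `λ ≥ 0` and at `x*` with weight
  -- `λ* ≥ 0`.
  have h12 : ⟪l - ls, 𝒢.G u - 𝒢.G xs⟫_ℝ ≤ ⟪u - xs, 𝒢.gradGT u l - 𝒢.gradGT xs ls⟫_ℝ := by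
    rw [← neg_sub u xs, ← neg_sub (𝒢.G u) (𝒢.G xs), inner_neg_right, inner_neg_right] at h10
    rw [inner_sub_left, inner_sub_right (u - xs), real_inner_comm _ (u - xs),
      real_inner_comm _ (u - xs)]
    linarith
  have h13 : min c c' * ‖s.2.1‖ ^ 2 ≤ c' * ‖s.2.1‖ ^ 2 := by gcongr; exact min_le_right _ _
  have h14 : min c c' * ‖s.2.2.2‖ ^ 2 ≤ c * ‖s.2.2.2‖ ^ 2 := by gcongr; exact min_le_left _ _
  linarith

end Dissipation

section Signals

variable {ι : Type*} [Fintype ι] {n p q r : ι → ℕ} {m : ℕ}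
  {K : Compensators ι n p q r m} {Px : ∀ i, Matrix (Fin (p i)) (Fin (p i)) ℝ}
  {Pz : ∀ i, Matrix (Fin (q i)) (Fin (q i)) ℝ}

/-! ### The signals and the total storage -/

theorem Compensators.continuous_xOut (K : Compensators ι n p q r m) : Continuous K.xOut := by
  rw [funext K.xOut_eq]
  fun_prop

theorem Compensators.continuous_zOut (K : Compensators ι n p q r m) : Continuous K.zOut := by
  rw [funext K.zOut_eq]
  fun_prop

theorem Compensators.continuous_lamOut (K : Compensators ι n p q r m) :
    Continuous K.lamOut := by
  rw [funext K.lamOut_eq]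
  exact continuous_fst.add (continuous_blockPos.comp (by fun_prop))

/-- The total storage function centred at `((x*, 0), (λ*, 0, z*, 0))`. -/
noncomputable def totalStorage (Px : ∀ i, Matrix (Fin (p i)) (Fin (p i)) ℝ)
    (Pz : ∀ i, Matrix (Fin (q i)) (Fin (q i)) ℝ) (xs : BlockVec n) (ls zs : AgentVec ι m)
    (s : FullState n p q r m) : ℝ :=
  storageX Px xs s.1 + storageLZ Pz ls zs s.2

theorem contDiff_totalStorage (xs : BlockVec n) (ls zs : AgentVec ι m) :
    ContDiff ℝ 1 (totalStorage (r := r) Px Pz xs ls zs) :=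
  ((contDiff_storageX Px xs).comp contDiff_fst).add
    ((contDiff_storageLZ Pz ls zs).comp contDiff_snd)

theorem totalStorage_coercive (hPx : ∀ i, (Px i).PosDef) (hPz : ∀ i, (Pz i).PosDef) :
    ∃ c > 0, ∀ (xs : BlockVec n) (ls zs : AgentVec ι m) (s : FullState n p q r m),
      c * ‖s - ((xs, 0), (ls, 0, zs, 0))‖ ^ 2 ≤ totalStorage Px Pz xs ls zs s := by
  obtain ⟨c₁, hc₁, h₁⟩ := storageX_coercive (n := n) hPx
  obtain ⟨c₂, hc₂, h₂⟩ := storageLZ_coercive (r := r) (m := m) hPz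
  refine ⟨min c₁ c₂, by positivity, fun xs ls zs s => ?_⟩
  have e1 := h₁ xs s.1
  have e2 := h₂ ls zs s.2
  rw [Prod.norm_def, totalStorage, Prod.fst_sub, Prod.snd_sub]
  set A := ‖s.1 - (xs, 0)‖
  set B := ‖s.2 - (ls, 0, zs, 0)‖
  have e3 : min c₁ c₂ * A ^ 2 ≤ c₁ * A ^ 2 := by gcongr; exact min_le_left _ _
  have e4 : min c₁ c₂ * B ^ 2 ≤ c₂ * B ^ 2 := by gcongr; exact min_le_right _ _
  have e5 : 0 ≤ c₁ * A ^ 2 := by positivity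
  have e6 : 0 ≤ c₂ * B ^ 2 := by positivity
  rcases max_choice A B with h | h <;> rw [h] <;> linarith

variable [DecidableEq ι] {𝒢 : Game ι n m} {a : Matrix ι ι ℝ} {s : ℝ → FullState n p q r m}

/-- The signal `v_x`. -/
noncomputable def signalX (𝒢 : Game ι n m) (K : Compensators ι n p q r m) (s : FullState n p q r m) :
    BlockVec n :=
  - 𝒢.F (K.xOut s.1) - 𝒢.gradGT (K.xOut s.1) (K.lamOut s.2)

/-- The signal `v_z`. -/
def signalZ (a : Matrix ι ι ℝ) (K : Compensators ι n p q r m) (s : FullState n p q r m) :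
    AgentVec ι m :=
  lapMul a (K.lamOut s.2)

/-- The signal `v_λ`. -/
def signalL (𝒢 : Game ι n m) (a : Matrix ι ι ℝ) (K : Compensators ι n p q r m)
    (s : FullState n p q r m) : AgentVec ι m :=
  𝒢.G (K.xOut s.1) - lapMul a (K.zOut s.2) - signalZ a K s

/-- The right-hand side of the dynamics without the projections. -/
noncomputable def unprojectedField (𝒢 : Game ι n m) (a : Matrix ι ι ℝ)
    (K : Compensators ι n p q r m) (s : FullState n p q r m) : FullState n p q r m :=
  ((signalX 𝒢 K s, blockMulCLM K.Φx s.1.2 + blockMulCLM K.Θx (signalX 𝒢 K s)),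
    signalL 𝒢 a K s, blockMulCLM K.Φl s.2.2.1 + blockMulCLM K.Θl (signalL 𝒢 a K s),
    signalZ a K s, blockMulCLM K.Φz s.2.2.2.2 + blockMulCLM K.Θz (signalZ a K s))

theorem dynField_eq (s : FullState n p q r m) :
    dynField 𝒢 a K s = ((unprojectedField 𝒢 a K s).1,
      projOp (blockOrthant fun _ => m) s.2.1 (unprojectedField 𝒢 a K s).2.1,
      projOp (blockOrthant r) s.2.2.1 (unprojectedField 𝒢 a K s).2.2.1,
      (unprojectedField 𝒢 a K s).2.2.2) := rfl

/-- Dominates the discontinuous field by a continuous one, which is bounded on bounded sets. -/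
theorem norm_dynField_le {s : FullState n p q r m} (hs : s.2 ∈ stateSetLZ q r m) :
    ‖dynField 𝒢 a K s‖ ≤ ‖unprojectedField 𝒢 a K s‖ := by
  rw [dynField_eq]
  simp only [Prod.norm_def]
  exact max_le_max le_rfl (max_le_max (norm_projOp_le hs.1 _)
    (max_le_max (norm_projOp_le hs.2 _) le_rfl))

theorem continuous_signalX (h𝒢 : 𝒢.IsConvex) (hF : 𝒢.IsMonotone) :
    Continuous (signalX (q := q) (r := r) 𝒢 K) := by
  have hx : Continuous fun s : FullState n p q r m => K.xOut s.1 :=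
    K.continuous_xOut.comp continuous_fst
  have hl : Continuous fun s : FullState n p q r m => K.lamOut s.2 :=
    K.continuous_lamOut.comp continuous_snd
  have h1 : Continuous fun s : FullState n p q r m => 𝒢.F (K.xOut s.1) :=
    (h𝒢.continuous_F hF).comp hx
  have h2 := h𝒢.continuous_gradGT.comp (hx.prodMk hl)
  exact h1.neg.sub h2

theorem continuous_signalZ : Continuous (signalZ (n := n) (p := p) a K) :=
  (lapCLM a).continuous.comp (K.continuous_lamOut.comp continuous_snd)

theorem continuous_signalL (h𝒢 : 𝒢.IsConvex) : Continuous (signalL (p := p) 𝒢 a K) :=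
  ((h𝒢.continuous_G.comp (K.continuous_xOut.comp continuous_fst)).sub
    ((lapCLM a).continuous.comp (K.continuous_zOut.comp continuous_snd))).sub continuous_signalZ

theorem continuous_unprojectedField (h𝒢 : 𝒢.IsConvex) (hF : 𝒢.IsMonotone) :
    Continuous (unprojectedField 𝒢 a K) := by
  have h1 := continuous_signalX (K := K) h𝒢 hF
  have h2 := continuous_signalL (K := K) (a := a) h𝒢
  have h3 := continuous_signalZ (K := K) (a := a)
  unfold unprojectedField
  fun_prop

/-- The closed loop feeds each subsystem the output of the other, with one sign reversed, so the two
supply rates cancel and only the compensator losses survive. -/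
theorem totalStorage_dissipation {Gc : SimpleGraph ι} (h𝒢 : 𝒢.IsConvex)
    (ha : IsWeightedAdjacency Gc a) (hK : K.IsAdmissible Px Pz) (hF : 𝒢.IsMonotone) :
    ∃ c > 0, ∀ (xs : BlockVec n) (ls zs : AgentVec ι m), IsRestPoint 𝒢 a xs ls zs →
      ∀ s : FullState n p q r m, s.2 ∈ stateSetLZ q r m →
      fderiv ℝ (totalStorage Px Pz xs ls zs) s (dynField 𝒢 a K s)
        ≤ -(c * (‖s.1.2‖ ^ 2 + ‖s.2.2.1‖ ^ 2 + ‖s.2.2.2.2‖ ^ 2)) := by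
  obtain ⟨c₁, hc₁, h₁⟩ := sigmaX_dissipation hK hF
  obtain ⟨c₂, hc₂, h₂⟩ := sigmaLZ_dissipation h𝒢 ha hK
  refine ⟨min c₁ c₂, by positivity, fun xs ls zs hrest s hs => ?_⟩
  have e1 := h₁ xs s.1 (-𝒢.gradGT (K.xOut s.1) (K.lamOut s.2))
  have e2 := h₂ xs ls zs hrest s.2 hs (K.xOut s.1)
  have hdyn : dynField 𝒢 a K s = ((sigmaX 𝒢 K).field s.1 (-𝒢.gradGT (K.xOut s.1) (K.lamOut s.2)),
      (sigmaLZ 𝒢 a K).field s.2 (K.xOut s.1)) := by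
    simp only [sigmaX, ← sub_eq_add_neg]
    rfl
  have hdiff₁ : DifferentiableAt ℝ (storageX Px xs) s.1 :=
    (contDiff_storageX Px xs).differentiable one_ne_zero _
  have hdiff₂ : DifferentiableAt ℝ (storageLZ (r := r) Pz ls zs) s.2 :=
    (contDiff_storageLZ Pz ls zs).differentiable one_ne_zero _
  have hfd : HasFDerivAt (totalStorage Px Pz xs ls zs) _ s :=
    (hdiff₁.hasFDerivAt.comp s (hasFDerivAt_fst (𝕜 := ℝ))).add
      (hdiff₂.hasFDerivAt.comp s (hasFDerivAt_snd (𝕜 := ℝ)))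
  rw [hfd.fderiv, hdyn]
  change fderiv ℝ (storageX Px xs) s.1
      ((sigmaX 𝒢 K).field s.1 (-𝒢.gradGT (K.xOut s.1) (K.lamOut s.2)))
    + fderiv ℝ (storageLZ Pz ls zs) s.2 ((sigmaLZ 𝒢 a K).field s.2 (K.xOut s.1)) ≤ _
  have e3 : ⟪-𝒢.gradGT (K.xOut s.1) (K.lamOut s.2) - 𝒢.F xs, K.xOut s.1 - xs⟫_ℝ
      = -⟪K.xOut s.1 - xs, 𝒢.gradGT (K.xOut s.1) (K.lamOut s.2) - 𝒢.gradGT xs ls⟫_ℝ := by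
    rw [eq_neg_of_add_eq_zero_left hrest.stationary, real_inner_comm, ← inner_neg_right]
    congr 1
    abel
  have e4 : min c₁ c₂ * ‖s.1.2‖ ^ 2 ≤ c₁ * ‖s.1.2‖ ^ 2 := by gcongr; exact min_le_left _ _
  have e5 : min c₁ c₂ * (‖s.2.2.1‖ ^ 2 + ‖s.2.2.2.2‖ ^ 2)
      ≤ c₂ * (‖s.2.2.1‖ ^ 2 + ‖s.2.2.2.2‖ ^ 2) := by gcongr; exact min_le_right _ _
  linarith

end Signals

/-! ### Recovering vanishing inputs from vanishing compensator states -/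

section Trajectories

variable {ι : Type*} [Fintype ι] {n p q r : ι → ℕ} {m : ℕ}
  {K : Compensators ι n p q r m} {Px : ∀ i, Matrix (Fin (p i)) (Fin (p i)) ℝ}
  {Pz : ∀ i, Matrix (Fin (q i)) (Fin (q i)) ℝ}

theorem tendsto_zero_of_injective {E F : Type*} [NormedAddCommGroup E] [NormedSpace ℝ E]
    [NormedAddCommGroup F] [NormedSpace ℝ F] [FiniteDimensional ℝ E] (L : E →L[ℝ] F)
    (hL : Function.Injective L) {α : Type*} {l : Filter α} {v : α → E}
    (h : Tendsto (fun t => L (v t)) l (𝓝 0)) : Tendsto v l (𝓝 0) := by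
  have hemb := LinearMap.isClosedEmbedding_of_injective (f := (L : E →ₗ[ℝ] F))
    (LinearMap.ker_eq_bot.2 hL)
  rw [hemb.isInducing.tendsto_nhds_iff]
  simpa [Function.comp_def] using h

/-- A signal entering a linear system whose state and state derivative vanish asymptotically
through an injective input matrix vanishes asymptotically. -/
theorem tendsto_signal_of_state {d e : ι → ℕ} {A : ∀ i, Matrix (Fin (d i)) (Fin (d i)) ℝ}
    {B : ∀ i, Matrix (Fin (d i)) (Fin (e i)) ℝ} (hB : ∀ i, Function.Injective (B i).mulVec)
    {τ : ℝ → BlockVec d} {v : ℝ → BlockVec e}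
    (hτ : ∀ T : ℝ, 0 < T → AbsolutelyContinuousOnInterval τ 0 T)
    (hder : ∀ᵐ t : ℝ, 0 < t → HasDerivAt τ (blockMulCLM A (τ t) + blockMulCLM B (v t)) t)
    (hunif : UniformContinuousOn (fun t => blockMulCLM A (τ t) + blockMulCLM B (v t)) (Ici 0))
    (hlim : Tendsto τ atTop (𝓝 0)) : Tendsto v atTop (𝓝 0) := by
  have h1 := tendsto_zero_of_hasDerivAt_of_tendsto hτ hder hunif hlim
  have h2 : Tendsto (fun t => blockMulCLM A (τ t)) atTop (𝓝 0) := by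
    simpa [Function.comp_def] using ((blockMulCLM A).continuous.tendsto 0).comp hlim
  refine tendsto_zero_of_injective (blockMulCLM B) (blockMulCLM_injective hB) ?_
  simpa using h1.sub h2

variable [DecidableEq ι] {𝒢 : Game ι n m} {a : Matrix ι ι ℝ} {s : ℝ → FullState n p q r m}

/-! ### Trajectories -/

theorem IsTrajectory.absolutelyContinuous_comp {E : Type*} [NormedAddCommGroup E]
    [NormedSpace ℝ E] (hs : IsTrajectory 𝒢 a K s) {f : FullState n p q r m → E}
    (hf : ContDiff ℝ 1 f) (T : ℝ) (hT : 0 < T) :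
    AbsolutelyContinuousOnInterval (fun t => f (s t)) 0 T :=
  absolutelyContinuousOnInterval_contDiff_comp (hs.1 T hT) hf

theorem IsTrajectory.hasDerivAt_comp {E : Type*} [NormedAddCommGroup E]
    [NormedSpace ℝ E] (hs : IsTrajectory 𝒢 a K s) {f : FullState n p q r m → E}
    (hf : ContDiff ℝ 1 f) :
    ∀ᵐ t : ℝ, 0 < t → HasDerivAt (fun t => f (s t)) (fderiv ℝ f (s t) (dynField 𝒢 a K (s t))) t := by
  filter_upwards [hs.2.2] with t ht ht0
  exact (hf.differentiable one_ne_zero (s t)).hasFDerivAt.comp_hasDerivAt t (ht ht0)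

theorem IsTrajectory.hasDerivAt_clm {E : Type*} [NormedAddCommGroup E]
    [NormedSpace ℝ E] (hs : IsTrajectory 𝒢 a K s) (f : FullState n p q r m →L[ℝ] E) :
    ∀ᵐ t : ℝ, 0 < t → HasDerivAt (fun t => f (s t)) (f (dynField 𝒢 a K (s t))) t := by
  filter_upwards [hs.2.2] with t ht ht0
  exact f.hasFDerivAt.comp_hasDerivAt t (ht ht0)

theorem IsTrajectory.totalStorage_antitone {Gc : SimpleGraph ι} (hs : IsTrajectory 𝒢 a K s)
    (h𝒢 : 𝒢.IsConvex) (ha : IsWeightedAdjacency Gc a) (hK : K.IsAdmissible Px Pz)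
    (hF : 𝒢.IsMonotone) {xs : BlockVec n} {ls zs : AgentVec ι m}
    (hrest : IsRestPoint 𝒢 a xs ls zs) {t u : ℝ} (ht : 0 ≤ t) (htu : t ≤ u) :
    totalStorage Px Pz xs ls zs (s u) ≤ totalStorage Px Pz xs ls zs (s t) := by
  obtain ⟨c, hc, hdis⟩ := totalStorage_dissipation h𝒢 ha hK hF
  have hC := contDiff_totalStorage (r := r) (Px := Px) (Pz := Pz) xs ls zs
  have := sub_le_of_ae_hasDerivAt_le (c := 0) htu
    (absolutelyContinuousOnInterval_of_nonneg (hs.absolutelyContinuous_comp hC) ht htu) (by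
      filter_upwards [hs.hasDerivAt_comp hC] with v hv hvt
      have hv0 : 0 < v := ht.trans_lt hvt.1
      refine ⟨_, hv hv0, (hdis xs ls zs hrest _ (hs.2.1 v hv0.le)).trans ?_⟩
      rw [neg_nonpos]
      positivity)
  linarith

theorem IsTrajectory.exists_bound {Gc : SimpleGraph ι} (hs : IsTrajectory 𝒢 a K s)
    (h𝒢 : 𝒢.IsConvex) (ha : IsWeightedAdjacency Gc a) (hK : K.IsAdmissible Px Pz)
    (hF : 𝒢.IsMonotone) {xs : BlockVec n} {ls zs : AgentVec ι m}
    (hrest : IsRestPoint 𝒢 a xs ls zs) :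
    ∃ R, ∀ t, 0 ≤ t → s t ∈ Metric.closedBall (0 : FullState n p q r m) R := by
  obtain ⟨c, hc, hle⟩ := totalStorage_coercive (n := n) (r := r) (m := m)
    (fun i => (hK.1 i).1) fun i => (hK.2.1 i).1
  set e : FullState n p q r m := ((xs, 0), (ls, 0, zs, 0)) with he
  refine ⟨Real.sqrt (totalStorage Px Pz xs ls zs (s 0) / c) + ‖e‖, fun t ht => ?_⟩
  rw [mem_closedBall_zero_iff]
  have h1 := (hle xs ls zs (s t)).trans (hs.totalStorage_antitone h𝒢 ha hK hF hrest le_rfl ht)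
  have h2 : ‖s t - e‖ ≤ Real.sqrt (totalStorage Px Pz xs ls zs (s 0) / c) := by
    refine Real.le_sqrt_of_sq_le ?_
    rw [le_div_iff₀ hc]
    linarith
  calc ‖s t‖ = ‖(s t - e) + e‖ := by rw [sub_add_cancel]
    _ ≤ ‖s t - e‖ + ‖e‖ := norm_add_le _ _
    _ ≤ _ := by gcongr

/-- On a bounded trajectory the velocity is bounded, so the trajectory is Lipschitz, and continuous
functions are uniformly continuous on the ball containing it. This supplies the hypothesis of
Barbalat's lemma. -/
theorem IsTrajectory.uniformContinuousOn_comp {E : Type*} [PseudoMetricSpace E]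
    (hs : IsTrajectory 𝒢 a K s) (h𝒢 : 𝒢.IsConvex) (hF : 𝒢.IsMonotone) {R : ℝ}
    (hR : ∀ t, 0 ≤ t → s t ∈ Metric.closedBall (0 : FullState n p q r m) R)
    {w : FullState n p q r m → E} (hw : Continuous w) :
    UniformContinuousOn (fun t => w (s t)) (Ici 0) := by
  have : ProperSpace (FullState n p q r m) := FiniteDimensional.proper_real _
  have hcomp := isCompact_closedBall (0 : FullState n p q r m) R
  obtain ⟨M, hM⟩ := hcomp.exists_bound_of_continuousOn
    (continuous_unprojectedField (K := K) (a := a) h𝒢 hF).continuousOn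
  have hdist : ∀ t u, 0 ≤ t → t ≤ u → ‖s u - s t‖ ≤ M * (u - t) := fun t u ht htu =>
    norm_sub_le_of_ae_hasDerivAt htu (absolutelyContinuousOnInterval_of_nonneg hs.1 ht htu) (by
      filter_upwards [hs.2.2] with v hv hvt
      have hv0 : 0 < v := ht.trans_lt hvt.1
      exact ⟨_, hv hv0, (norm_dynField_le (hs.2.1 v hv0.le)).trans (hM _ (hR v hv0.le))⟩)
  have hlip : LipschitzOnWith (Real.toNNReal M) s (Ici 0) := by
    refine LipschitzOnWith.of_dist_le' fun t ht u hu => ?_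
    rw [dist_eq_norm, Real.dist_eq]
    rcases le_total t u with h | h
    · rw [norm_sub_rev, abs_sub_comm, abs_of_nonneg (sub_nonneg.2 h)]
      exact hdist t u ht h
    · rw [abs_of_nonneg (sub_nonneg.2 h)]
      exact hdist u t hu h
  exact (hcomp.uniformContinuousOn_of_continuous hw.continuousOn).comp
    hlip.uniformContinuousOn fun t ht => hR t ht

theorem IsTrajectory.totalStorage_convergent {Gc : SimpleGraph ι} (hs : IsTrajectory 𝒢 a K s)
    (h𝒢 : 𝒢.IsConvex) (ha : IsWeightedAdjacency Gc a) (hK : K.IsAdmissible Px Pz)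
    (hF : 𝒢.IsMonotone) {xs : BlockVec n} {ls zs : AgentVec ι m}
    (hrest : IsRestPoint 𝒢 a xs ls zs) :
    ∃ l, Tendsto (fun t => totalStorage Px Pz xs ls zs (s t)) atTop (𝓝 l) := by
  obtain ⟨c, hc, hcoer⟩ := totalStorage_coercive (n := n) (r := r) (m := m)
    (fun i => (hK.1 i).1) fun i => (hK.2.1 i).1
  -- Time is clipped at zero because nothing is known about `s` before it.
  have hanti : Antitone fun t => totalStorage Px Pz xs ls zs (s (max t 0)) := fun t u htu =>
    hs.totalStorage_antitone h𝒢 ha hK hF hrest (le_max_right _ _) (max_le_max_right _ htu)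
  have hbdd : BddBelow (range fun t => totalStorage Px Pz xs ls zs (s (max t 0))) := by
    refine ⟨0, ?_⟩
    rintro _ ⟨t, rfl⟩
    refine le_trans ?_ (hcoer xs ls zs _)
    exact mul_nonneg hc.le (sq_nonneg _)
  refine ⟨_, (tendsto_atTop_ciInf hanti hbdd).congr' ?_⟩
  filter_upwards [eventually_ge_atTop 0] with t ht
  rw [max_eq_left ht]

theorem IsTrajectory.tendsto_compensators_sq {Gc : SimpleGraph ι} (hs : IsTrajectory 𝒢 a K s)
    (h𝒢 : 𝒢.IsConvex) (ha : IsWeightedAdjacency Gc a) (hK : K.IsAdmissible Px Pz)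
    (hF : 𝒢.IsMonotone) {xs : BlockVec n} {ls zs : AgentVec ι m}
    (hrest : IsRestPoint 𝒢 a xs ls zs) :
    Tendsto (fun t => ‖(s t).1.2‖ ^ 2 + ‖(s t).2.2.1‖ ^ 2 + ‖(s t).2.2.2.2‖ ^ 2) atTop (𝓝 0) := by
  obtain ⟨R, hR⟩ := hs.exists_bound h𝒢 ha hK hF hrest
  obtain ⟨c, hc, hdis⟩ := totalStorage_dissipation h𝒢 ha hK hF
  obtain ⟨l, hl⟩ := hs.totalStorage_convergent h𝒢 ha hK hF hrest
  have hC : ContDiff ℝ 1 (totalStorage (r := r) Px Pz xs ls zs) := contDiff_totalStorage xs ls zs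
  have hWc : Continuous fun s : FullState n p q r m =>
      c * (‖s.1.2‖ ^ 2 + ‖s.2.2.1‖ ^ 2 + ‖s.2.2.2.2‖ ^ 2) := by fun_prop
  have hunif := hs.uniformContinuousOn_comp h𝒢 hF hR hWc
  have hac := hs.absolutelyContinuous_comp hC.neg
  have hder := hs.hasDerivAt_comp hC
  have hev : ∀ ε > 0, ∀ᶠ t in atTop,
      c * (‖(s t).1.2‖ ^ 2 + ‖(s t).2.2.1‖ ^ 2 + ‖(s t).2.2.2.2‖ ^ 2) ≤ ε := fun ε hε =>
    eventually_le_of_tendsto_of_le_hasDerivAt hac (by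
        filter_upwards [hder] with t ht ht0
        refine ⟨_, (ht ht0).neg, ?_⟩
        have := hdis xs ls zs hrest (s t) (hs.2.1 t ht0.le)
        linarith) hunif hl.neg hε
  rw [Metric.tendsto_nhds]
  intro ε hε
  filter_upwards [hev (c * (ε / 2)) (by positivity)] with t ht
  rw [Real.dist_eq, sub_zero, abs_of_nonneg (by positivity)]
  have := le_of_mul_le_mul_left ht hc
  linarith

theorem IsTrajectory.tendsto_compensators {Gc : SimpleGraph ι} (hs : IsTrajectory 𝒢 a K s)
    (h𝒢 : 𝒢.IsConvex) (ha : IsWeightedAdjacency Gc a) (hK : K.IsAdmissible Px Pz)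
    (hF : 𝒢.IsMonotone) {xs : BlockVec n} {ls zs : AgentVec ι m}
    (hrest : IsRestPoint 𝒢 a xs ls zs) :
    Tendsto (fun t => (s t).1.2) atTop (𝓝 0) ∧ Tendsto (fun t => (s t).2.2.1) atTop (𝓝 0) ∧
      Tendsto (fun t => (s t).2.2.2.2) atTop (𝓝 0) := by
  have hsq := hs.tendsto_compensators_sq h𝒢 ha hK hF hrest
  have hsqrt := (Real.continuous_sqrt.tendsto 0).comp hsq
  rw [Real.sqrt_zero] at hsqrt
  have hnn : ∀ t, 0 ≤ ‖(s t).1.2‖ ^ 2 ∧ 0 ≤ ‖(s t).2.2.1‖ ^ 2 ∧ 0 ≤ ‖(s t).2.2.2.2‖ ^ 2 :=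
    fun t => ⟨sq_nonneg _, sq_nonneg _, sq_nonneg _⟩
  refine ⟨squeeze_zero_norm (fun t => Real.le_sqrt_of_sq_le ?_) hsqrt,
    squeeze_zero_norm (fun t => Real.le_sqrt_of_sq_le ?_) hsqrt,
    squeeze_zero_norm (fun t => Real.le_sqrt_of_sq_le ?_) hsqrt⟩ <;>
  linarith [(hnn t).1, (hnn t).2.1, (hnn t).2.2]

/-- Barbalat's lemma applies because the `τ_x` and `τ_z` equations are unprojected, so their
velocities are continuous in the state. The projected `τ_λ` equation gives no such information on
`v_λ`. -/
theorem IsTrajectory.tendsto_signals {Gc : SimpleGraph ι} (hs : IsTrajectory 𝒢 a K s)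
    (h𝒢 : 𝒢.IsConvex) (ha : IsWeightedAdjacency Gc a) (hK : K.IsAdmissible Px Pz)
    (hF : 𝒢.IsMonotone) {xs : BlockVec n} {ls zs : AgentVec ι m}
    (hrest : IsRestPoint 𝒢 a xs ls zs) :
    Tendsto (fun t => signalX 𝒢 K (s t)) atTop (𝓝 0) ∧
      Tendsto (fun t => signalZ a K (s t)) atTop (𝓝 0) := by
  obtain ⟨R, hR⟩ := hs.exists_bound h𝒢 ha hK hF hrest
  obtain ⟨hτx, -, hτz⟩ := hs.tendsto_compensators h𝒢 ha hK hF hrest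
  have hc := continuous_unprojectedField (K := K) (a := a) h𝒢 hF
  constructor
  · exact tendsto_signal_of_state (A := K.Φx) (fun i => (hK.1 i).2.1)
      (hs.absolutelyContinuous_comp (contDiff_snd.comp contDiff_fst))
      (hs.hasDerivAt_clm ((ContinuousLinearMap.snd ℝ _ _).comp (.fst ℝ _ _)))
      (hs.uniformContinuousOn_comp h𝒢 hF hR (continuous_snd.comp (continuous_fst.comp hc))) hτx
  · exact tendsto_signal_of_state (A := K.Φz) (fun i => (hK.2.1 i).2.1)
      (hs.absolutelyContinuous_comp
        (contDiff_snd.comp (contDiff_snd.comp (contDiff_snd.comp contDiff_snd))))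
      (hs.hasDerivAt_clm ((ContinuousLinearMap.snd ℝ _ _).comp
        ((ContinuousLinearMap.snd ℝ _ _).comp ((ContinuousLinearMap.snd ℝ _ _).comp
          (.snd ℝ _ _)))))
      (hs.uniformContinuousOn_comp h𝒢 hF hR (continuous_snd.comp (continuous_snd.comp
        (continuous_snd.comp (continuous_snd.comp hc))))) hτz

/-! ### Cluster points of trajectories -/

theorem IsTrajectory.tendsto_window_clm {E : Type*} [NormedAddCommGroup E] [NormedSpace ℝ E]
    [FiniteDimensional ℝ E] (hs : IsTrajectory 𝒢 a K s) (L : FullState n p q r m →L[ℝ] E)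
    (hL : Tendsto (fun t => L (dynField 𝒢 a K (s t))) atTop (𝓝 0)) {t : ℕ → ℝ}
    (ht : Tendsto t atTop atTop) {s' : FullState n p q r m}
    (hlim : Tendsto (fun k => s (t k)) atTop (𝓝 s')) (T : ℝ) :
    Tendsto (fun k : ℕ × ℝ => L (s (t k.1 + k.2))) (atTop ×ˢ 𝓟 (Icc (-T) T)) (𝓝 (L s')) :=
  tendsto_window_of_hasDerivAt (hs.absolutelyContinuous_comp L.contDiff) (hs.hasDerivAt_clm L) hL
    ht ((L.continuous.tendsto s').comp hlim) T

/-- Along windows that follow a convergent sequence of states, `v_λ` is asymptotically constant. -/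
theorem IsTrajectory.tendsto_window_signalL {Gc : SimpleGraph ι} (hs : IsTrajectory 𝒢 a K s)
    (h𝒢 : 𝒢.IsConvex) (ha : IsWeightedAdjacency Gc a) (hK : K.IsAdmissible Px Pz)
    (hF : 𝒢.IsMonotone) {xs : BlockVec n} {ls zs : AgentVec ι m}
    (hrest : IsRestPoint 𝒢 a xs ls zs) {t : ℕ → ℝ} (ht : Tendsto t atTop atTop)
    {s' : FullState n p q r m} (hlim : Tendsto (fun k => s (t k)) atTop (𝓝 s')) (T : ℝ) :
    Tendsto (fun k : ℕ × ℝ => signalL 𝒢 a K (s (t k.1 + k.2))) (atTop ×ˢ 𝓟 (Icc (-T) T))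
      (𝓝 (𝒢.G s'.1.1 - lapMul a s'.2.2.2.1)) := by
  obtain ⟨hτx, -, hτz⟩ := hs.tendsto_compensators h𝒢 ha hK hF hrest
  obtain ⟨hvx, hvz⟩ := hs.tendsto_signals h𝒢 ha hK hF hrest
  have hshift : Tendsto (fun k : ℕ × ℝ => t k.1 + k.2) (atTop ×ˢ 𝓟 (Icc (-T) T)) atTop := by
    rw [tendsto_atTop]
    intro b
    rw [eventually_prod_principal_iff]
    filter_upwards [ht.eventually_ge_atTop (b + T)] with k hk h hh
    linarith [hh.1]
  have hρx : Tendsto (fun k : ℕ × ℝ => (s (t k.1 + k.2)).1.1) (atTop ×ˢ 𝓟 (Icc (-T) T))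
      (𝓝 s'.1.1) :=
    hs.tendsto_window_clm ((ContinuousLinearMap.fst ℝ (BlockVec n) (BlockVec p)).comp
      (.fst ℝ (StateX n p) (StateLZ q r m))) hvx ht hlim T
  have hρz : Tendsto (fun k : ℕ × ℝ => (s (t k.1 + k.2)).2.2.2.1) (atTop ×ˢ 𝓟 (Icc (-T) T))
      (𝓝 s'.2.2.2.1) :=
    hs.tendsto_window_clm ((ContinuousLinearMap.fst ℝ (AgentVec ι m) (BlockVec q)).comp
      ((ContinuousLinearMap.snd ℝ (BlockVec r) (AgentVec ι m × BlockVec q)).comp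
        ((ContinuousLinearMap.snd ℝ (AgentVec ι m) (BlockVec r × AgentVec ι m × BlockVec q)).comp
          (.snd ℝ (StateX n p) (StateLZ q r m))))) hvz ht hlim T
  have hηx := ((blockMulCLM K.Ψx).continuous.tendsto 0).comp (hτx.comp hshift)
  have hηz := ((blockMulCLM K.Ψz).continuous.tendsto 0).comp (hτz.comp hshift)
  have hx := hρx.add hηx
  have hz := hρz.add hηz
  rw [map_zero, add_zero] at hx hz
  have h1 := (h𝒢.continuous_G.tendsto _).comp hx
  have h2 := ((lapCLM (m := m) a).continuous.tendsto _).comp hz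
  -- The term `L λ` in `v_λ` is `v_z`, which vanishes asymptotically, so no control of `λ` on the
  -- window is needed.
  have h3 := (h1.sub h2).sub (hvz.comp hshift)
  rw [sub_zero] at h3
  exact h3

theorem IsTrajectory.complementary_of_tendsto {Gc : SimpleGraph ι} (hs : IsTrajectory 𝒢 a K s)
    (h𝒢 : 𝒢.IsConvex) (ha : IsWeightedAdjacency Gc a) (hK : K.IsAdmissible Px Pz)
    (hF : 𝒢.IsMonotone) {xs : BlockVec n} {ls zs : AgentVec ι m}
    (hrest : IsRestPoint 𝒢 a xs ls zs) {t : ℕ → ℝ} (ht : Tendsto t atTop atTop)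
    {s' : FullState n p q r m} (hlim : Tendsto (fun k => s (t k)) atTop (𝓝 s')) (i : ι)
    (k : Fin m) :
    (𝒢.G s'.1.1 - lapMul a s'.2.2.2.1) i k ≤ 0 ∧
      (s'.2.1 i k ≠ 0 → (𝒢.G s'.1.1 - lapMul a s'.2.2.2.1) i k = 0) := by
  have : ProperSpace (FullState n p q r m) := FiniteDimensional.proper_real _
  obtain ⟨R, hR⟩ := hs.exists_bound h𝒢 ha hK hF hrest
  let coord : FullState n p q r m →L[ℝ] ℝ := (EuclideanSpace.proj k).comp
    ((PiLp.proj 2 (fun _ : ι => Vec m) i).comp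
      ((ContinuousLinearMap.fst ℝ (AgentVec ι m) (BlockVec r × AgentVec ι m × BlockVec q)).comp
        (.snd ℝ (StateX n p) (StateLZ q r m))))
  have hcoord : ∀ s, coord s = s.2.1 i k := fun _ => rfl
  obtain ⟨M, hM⟩ := (isCompact_closedBall (0 : FullState n p q r m) R).exists_bound_of_continuousOn
    coord.continuous.continuousOn
  have hac := hs.absolutelyContinuous_comp coord.contDiff
  have hder := hs.hasDerivAt_clm coord
  have hcl := (coord.continuous.tendsto s').comp hlim
  have hwin : ∀ T : ℝ, Tendsto (fun j : ℕ × ℝ => signalL 𝒢 a K (s (t j.1 + j.2)) i k)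
      (atTop ×ˢ 𝓟 (Icc (-T) T)) (𝓝 ((𝒢.G s'.1.1 - lapMul a s'.2.2.2.1) i k)) := fun T =>
    ((continuous_blockVec_apply (d := fun _ : ι => m) i k).tendsto _).comp
      (hs.tendsto_window_signalL h𝒢 ha hK hF hrest ht hlim T)
  have hnn : ∀ u, 0 ≤ u → 0 ≤ coord (s u) := fun u hu => (hs.2.1 u hu).1 i k
  have hbd : ∀ u, 0 ≤ u → coord (s u) ≤ M := fun u hu => (le_abs_self _).trans (hM _ (hR u hu))
  rw [← hcoord]
  refine projected_limit_complementary (w := fun u => signalL 𝒢 a K (s u) i k) hac hnn hbd ?_ ht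
    hcl hwin
  filter_upwards [hder] with u hu hu0
  have h1 := projOp_blockOrthant_apply (hs.2.1 u hu0.le).1 (signalL 𝒢 a K (s u)) i k
  rw [hcoord, ← h1]
  exact hu hu0

/-- The field is discontinuous, so the equation itself cannot be passed to the limit. All rest point
conditions except complementarity are closed conditions on continuous signals; complementarity comes
from the window argument. -/
theorem IsTrajectory.isEquilibrium_of_tendsto {Gc : SimpleGraph ι} (hs : IsTrajectory 𝒢 a K s)
    (h𝒢 : 𝒢.IsConvex) (ha : IsWeightedAdjacency Gc a) (hK : K.IsAdmissible Px Pz)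
    (hF : 𝒢.IsMonotone) {xs : BlockVec n} {ls zs : AgentVec ι m}
    (hrest : IsRestPoint 𝒢 a xs ls zs) {t : ℕ → ℝ} (ht : Tendsto t atTop atTop)
    {s' : FullState n p q r m} (hlim : Tendsto (fun k => s (t k)) atTop (𝓝 s')) :
    IsEquilibrium 𝒢 a K s' := by
  obtain ⟨hτx, hτl, hτz⟩ := hs.tendsto_compensators h𝒢 ha hK hF hrest
  obtain ⟨hvx, hvz⟩ := hs.tendsto_signals h𝒢 ha hK hF hrest
  have hcompl := hs.complementary_of_tendsto h𝒢 ha hK hF hrest ht hlim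
  have hx0 : s'.1.2 = 0 := tendsto_nhds_unique
    (((continuous_snd.comp continuous_fst).tendsto s').comp hlim) (hτx.comp ht)
  have hl0 : s'.2.2.1 = 0 := tendsto_nhds_unique
    (((continuous_fst.comp (continuous_snd.comp continuous_snd)).tendsto s').comp hlim)
    (hτl.comp ht)
  have hz0 : s'.2.2.2.2 = 0 := tendsto_nhds_unique
    (((continuous_snd.comp (continuous_snd.comp
      (continuous_snd.comp continuous_snd))).tendsto s').comp hlim) (hτz.comp ht)
  have hsx := tendsto_nhds_unique (((continuous_signalX h𝒢 hF).tendsto s').comp hlim)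
    (hvx.comp ht)
  have hsz := tendsto_nhds_unique ((continuous_signalZ.tendsto s').comp hlim) (hvz.comp ht)
  have hmem : s'.2.1 ∈ blockOrthant fun _ => m := fun i k => by
    have hcont : Continuous fun s : FullState n p q r m => s.2.1 i k :=
      (continuous_blockVec_apply (d := fun _ : ι => m) i k).comp (continuous_fst.comp continuous_snd)
    refine ge_of_tendsto ((hcont.tendsto s').comp hlim) ?_
    filter_upwards [ht.eventually_ge_atTop 0] with j hj using (hs.2.1 _ hj).1 i k
  have hsmem : s'.2 ∈ stateSetLZ q r m := by
    refine ⟨hmem, ?_⟩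
    rw [hl0]
    exact fun _ _ => le_rfl
  have e1 : K.xOut s'.1 = s'.1.1 := by rw [K.xOut_eq, hx0, map_zero, add_zero]
  have e2 : K.lamOut s'.2 = s'.2.1 := by rw [hK.lamOut_of_mem hsmem, hl0, map_zero, add_zero]
  rw [signalX, e1, e2] at hsx
  rw [signalZ, e2] at hsz
  rw [isEquilibrium_iff hK]
  refine ⟨hx0, hl0, hz0, hmem, ?_, hsz, hcompl⟩
  rw [← neg_eq_zero, neg_add, ← sub_eq_add_neg]
  exact hsx

/-- A cluster point is an equilibrium, so the storage may be recentred at it. The recentred storage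
is nonincreasing and tends to zero along a subsequence; by coercivity the whole trajectory
converges. -/
theorem IsTrajectory.exists_tendsto_equilibrium {Gc : SimpleGraph ι}
    (hs : IsTrajectory 𝒢 a K s) (h𝒢 : 𝒢.IsConvex) (ha : IsWeightedAdjacency Gc a)
    (hK : K.IsAdmissible Px Pz) (hF : 𝒢.IsMonotone) {xs : BlockVec n} {ls zs : AgentVec ι m}
    (hrest : IsRestPoint 𝒢 a xs ls zs) :
    ∃ s', IsEquilibrium 𝒢 a K s' ∧ Tendsto s atTop (𝓝 s') := by
  have : ProperSpace (FullState n p q r m) := FiniteDimensional.proper_real _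
  obtain ⟨R, hR⟩ := hs.exists_bound h𝒢 ha hK hF hrest
  obtain ⟨s', -, φ, hφ, hlim⟩ := (isCompact_closedBall (0 : FullState n p q r m) R).tendsto_subseq
    (x := fun k : ℕ => s k) fun k => hR k (Nat.cast_nonneg k)
  have ht : Tendsto (fun k => (φ k : ℝ)) atTop atTop :=
    tendsto_natCast_atTop_atTop.comp hφ.tendsto_atTop
  have heq := hs.isEquilibrium_of_tendsto h𝒢 ha hK hF hrest ht hlim
  refine ⟨s', heq, ?_⟩
  obtain ⟨⟨ρx, τx⟩, ρl, τl, ρz, τz⟩ := s'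
  obtain ⟨h1, h2, h3, hrest'⟩ := (isEquilibrium_iff hK _).1 heq
  simp only at h1 h2 h3 hrest'
  subst h1 h2 h3
  obtain ⟨c, hc, hcoer⟩ := totalStorage_coercive (n := n) (r := r) (m := m)
    (fun i => (hK.1 i).1) fun i => (hK.2.1 i).1
  have hV0 : totalStorage (r := r) Px Pz ρx ρl ρz ((ρx, 0), ρl, 0, ρz, 0) = 0 := by
    simp [totalStorage, storageX_apply, storageLZ_apply]
  have hVlim := ((contDiff_totalStorage (r := r) (Px := Px) (Pz := Pz) ρx ρl ρz).continuous.tendsto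
    _).comp hlim
  rw [hV0] at hVlim
  rw [Metric.tendsto_atTop]
  intro ε hε
  obtain ⟨k, hk⟩ := (hVlim.eventually_lt_const (show 0 < c * ε ^ 2 by positivity)).exists
  refine ⟨φ k, fun t hkt => ?_⟩
  rw [dist_eq_norm]
  have h4 := hs.totalStorage_antitone h𝒢 ha hK hF hrest' (Nat.cast_nonneg (φ k)) hkt
  have h5 := hcoer ρx ρl ρz (s t)
  have h6 : c * ‖s t - ((ρx, 0), ρl, 0, ρz, 0)‖ ^ 2 < c * ε ^ 2 :=
    (h5.trans h4).trans_lt hk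
  exact lt_of_pow_lt_pow_left₀ 2 hε.le (lt_of_mul_lt_mul_left h6 hc.le)

/-! ### Passivity of the subsystems -/

theorem sigmaX_isPassive (hK : K.IsAdmissible Px Pz) (hF : 𝒢.IsMonotone)
    {xs : BlockVec n} {ls zs : AgentVec ι m} (hrest : IsRestPoint 𝒢 a xs ls zs) :
    (sigmaX 𝒢 K).IsPassive (storageX Px xs) (xs, 0) (-𝒢.gradGT xs ls) xs := by
  obtain ⟨c, hc, hdis⟩ := sigmaX_dissipation hK hF
  obtain ⟨c', hc', hcoer⟩ := storageX_coercive (n := n) fun i => (hK.1 i).1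
  have hF0 := eq_neg_of_add_eq_zero_left hrest.stationary
  have e1 : K.xOut (xs, 0) = xs := by simp [K.xOut_eq]
  refine ⟨mem_univ _, ?_, e1, isStorage_of_le (contDiff_storageX Px xs) ?_ hc' (hcoer xs),
    fun s _ u => ?_⟩
  · simp only [sigmaX, Compensators.fieldX, e1, hF0, neg_neg, add_neg_cancel,
      ← blockMulCLM_apply, map_zero, add_zero]
    rfl
  · simp [storageX_apply]
  · refine (hdis xs s u).trans ?_
    rw [hF0]
    have : 0 ≤ c * ‖s.2‖ ^ 2 := by positivity
    exact sub_le_self _ this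

theorem sigmaLZ_isPassive {Gc : SimpleGraph ι} (h𝒢 : 𝒢.IsConvex)
    (ha : IsWeightedAdjacency Gc a) (hK : K.IsAdmissible Px Pz)
    {xs : BlockVec n} {ls zs : AgentVec ι m} (hrest : IsRestPoint 𝒢 a xs ls zs) :
    (sigmaLZ 𝒢 a K).IsPassive (storageLZ Pz ls zs) (ls, 0, zs, 0) xs (𝒢.gradGT xs ls) := by
  obtain ⟨c, hc, hdis⟩ := sigmaLZ_dissipation h𝒢 ha hK
  obtain ⟨c', hc', hcoer⟩ := storageLZ_coercive (r := r) (m := m) fun i => (hK.2.1 i).1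
  have heq : IsEquilibrium 𝒢 a K ((xs, 0), (ls, 0, zs, 0)) :=
    (isEquilibrium_iff hK _).2 ⟨rfl, rfl, rfl, hrest⟩
  have e1 : K.xOut (xs, 0) = xs := by simp [K.xOut_eq]
  have e2 : K.lamOut (ls, 0, zs, 0) = ls := by rw [hK.lamOut_of_mem heq.1]; simp
  refine ⟨heq.1, ?_, ?_, isStorage_of_le (contDiff_storageLZ Pz ls zs) ?_ hc' (hcoer ls zs),
    fun s hs u => ?_⟩
  · have := congrArg Prod.snd heq.2
    simp only [dynField, e1] at this
    exact this
  · simp only [sigmaLZ, e2]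
  · simp [storageLZ_apply]
  · refine (hdis xs ls zs hrest s hs u).trans ?_
    have : 0 ≤ c * (‖s.2.1‖ ^ 2 + ‖s.2.2.2‖ ^ 2) := by positivity
    exact sub_le_self _ this

end Trajectories

end GradientPlay

theorem theorem2 {ι : Type*} [Fintype ι] [DecidableEq ι] {n p q r : ι → ℕ} {m : ℕ}
    (𝒢 : Game ι n m) (Gc : SimpleGraph ι) (a : Matrix ι ι ℝ)
    (K : Compensators ι n p q r m)
    (Px : ∀ i, Matrix (Fin (p i)) (Fin (p i)) ℝ) (Pz : ∀ i, Matrix (Fin (q i)) (Fin (q i)) ℝ)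
    (hconv : 𝒢.IsConvex) (ha : IsWeightedAdjacency Gc a) (hGc : Gc.Connected)
    (hK : K.IsAdmissible Px Pz) (hF : 𝒢.IsMonotone) :
    -- (i) and (ii): passivity with respect to every equilibrium point
    (∀ s : FullState n p q r m, IsEquilibrium 𝒢 a K s →
      (sigmaX 𝒢 K).IsPassive (storageX Px (K.xOut s.1)) s.1
        (- 𝒢.gradGT (K.xOut s.1) (K.lamOut s.2)) (K.xOut s.1) ∧
      (sigmaLZ 𝒢 a K).IsPassive (storageLZ Pz (K.lamOut s.2) (K.zOut s.2)) s.2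
        (K.xOut s.1) (𝒢.gradGT (K.xOut s.1) (K.lamOut s.2))) ∧
    -- (iii): convergence, for games that have a variational GNE
    ((∃ x, 𝒢.IsVariationalGNE x) →
      ∀ s : ℝ → FullState n p q r m, IsTrajectory 𝒢 a K s →
        ∃ s' : FullState n p q r m, IsEquilibrium 𝒢 a K s' ∧
          Tendsto s atTop (𝓝 s') ∧
          Tendsto (fun t => K.xOut (s t).1) atTop (𝓝 (K.xOut s'.1)) ∧
          𝒢.IsVariationalGNE (K.xOut s'.1)) := by
  refine ⟨fun s hs => ?_, ?_⟩
  · obtain ⟨⟨ρx, τx⟩, ρl, τl, ρz, τz⟩ := s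
    have hmem := hs.1
    obtain ⟨h1, h2, h3, hrest⟩ := (isEquilibrium_iff hK _).1 hs
    simp only at h1 h2 h3 hrest
    subst h1 h2 h3
    have e1 : K.xOut (ρx, 0) = ρx := by simp [K.xOut_eq]
    have e2 : K.lamOut (ρl, 0, ρz, 0) = ρl := by rw [hK.lamOut_of_mem hmem]; simp
    have e3 : K.zOut (ρl, 0, ρz, 0) = ρz := by simp [K.zOut_eq]
    simp only [e1, e2, e3]
    exact ⟨sigmaX_isPassive hK hF hrest, sigmaLZ_isPassive hconv ha hK hrest⟩
  · rintro ⟨x, hx⟩ s hs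
    -- The given variational GNE only provides a first centre for the storage, hence boundedness;
    -- the limit may be a different one.
    obtain ⟨l, z, hrest⟩ := hx.exists_restPoint ha hGc
    obtain ⟨s', heq, hlim⟩ := hs.exists_tendsto_equilibrium hconv ha hK hF hrest
    refine ⟨s', heq, hlim, ((K.continuous_xOut.comp continuous_fst).tendsto s').comp hlim, ?_⟩
    obtain ⟨h1, -, -, hrest'⟩ := (isEquilibrium_iff hK s').1 heq
    have e1 : K.xOut s'.1 = s'.1.1 := by rw [K.xOut_eq, h1, map_zero, add_zero]
    rw [e1]
    exact hrest'.isVariationalGNE hconv ha hGc
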